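/- **Theorem (complexity of $\mathrm{FPE}_p$).** Let $P(z)=\sum_{k=0}^d a_kz^k\in\mathbb{C}[z]$ have degree $d\ge1$ with $a_0\neq0$, and let $p\ge1$ be a bit precision. For $z\ne 0$ let $s(z)=1+\lfloor\log_2|z|\rfloor$, and $s(0)=-\infty$. Let $\widehat E_P$ be the concave cover of the scales, i.e. the smallest concave function on $[0,d]$ with $\widehat E_P(k)\ge s(a_k)$ for $k=0,\dots,d$; put $\tau=p+s(d)+3$ and $G_p=\{k\in\{0,\dots,d\} : s(a_k)\ge\widehat E_P(k)-\tau\}$. The algorithm $\mathrm{FPE}_p$ has two phases. * *Preconditioning*: sort the indices by decreasing $s(a_k)$ (merge sort); build $\widehat E_P$ by inserting the indices in this order, the vertices to be removed at each insertion being found by binary search; list $G_p$ (the vertices of $\widehat E_P$ belong to it without a test). * *Evaluation at $z\in\mathbb{C}^*$*: with $\lambda=\log_2|z|$, find $k_\lambda$ maximizing $\widehat E_P(k)+\lambda k$ by binary search; let $N=\widehat E_P(k_\lambda)+\lambda k_\lambda$; find by binary search on each side of $k_\lambda$ the largest integer interval $[\ell,r]\subset[0,d]$ on which $\widehat E_P(k)+\lambda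 k\ge N-\tau$; compute $Q_\lambda(z)=\sum_{k\in G_p\cap[\ell,r]}a_kz^k$ by Hörner's method, starting at the degree $r$, and multiply by $z^\ell$, which is computed by repeated squaring. Costs are counted as follows. One operation (of unit time) is one comparison of two machine numbers given by expressions of bounded size (a scale, the height at an integer of the line through two points, a value $\widehat E_P(k)+\lambda k$, …). The computation of $\lambda$ is part of the first comparison of the search for $k_\lambda$; that of $N$ is part of a comparison with $\widehat E_P(0)$ (if $k_\lambda=0$, then $N$ is already stored). Reading the scale of a coefficient and handling indices are free. One multiplication followed by an addition of numbers with precision $p$ takes time $M(p)>0$. In memory, machine numbers take one word of a fixed number of bits, and coefficients take $O(p)$ bits and $O(1)$ words each. Then: 1. The preconditioning phase computes $\widehat E_P$ on $\{0,\dots,d\}$ and $G_p$ in time at most $d+2d\log_2 d$ and requires $O(dp)$ bits of memory, where the implied constant depends only on the word length. 2. In exact arithmetic, for $z\neq0$, the evaluation phase outputs $Q_\lambda(z)$. 3. For any rounding of the arithmetic at precision $p$, if $z$ is uniformly distributed on the Riemann sphere, i.e. with density $\frac{1}{\pi(1+|z|^2)^2}$ on $\mathbb{C}$, then the average evaluation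 time is less than $$2+3\log_2d+\Big(2\log_2d+1.9046\sqrt{d(p+\log_2d+4)}\Big)M(p).$$ 4. If moreover $P$ has real coefficients and $x$ is uniformly distributed on the circle $\mathbb{R}\cup\{\infty\}$, i.e. with density $\frac{1}{\pi(1+x^2)}$ on $\mathbb{R}$, then the average evaluation time at $x$ is less than $$2+3\log_2d+\Big(2\log_2d+1.7673\sqrt{d(p+\log_2d+4)}\Big)M(p).$$ 5. For every $z\neq0$, the evaluation time never exceeds $2+3\log_2d+M(p)\,d$. -/

import Mathlib

open MeasureTheory Polynomial

namespace FPE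

/-! ## Programs and machines

A program is a decision tree. It has no access to the numbers it works on: all that it learns about
them are the answers to its tests. A machine gives the tests and the actions their meaning. -/

/-- Programs with tests from `T` (two-way branches) and actions from `A`, returning an `α`. -/
inductive Prog (T A α : Type) : Type
  | ret (a : α) : Prog T A α
  | test (t : T) (next : Bool → Prog T A α) : Prog T A α
  | act (a : A) (next : Prog T A α) : Prog T A α

/-- Sequential composition. -/
def Prog.bind {T A α β : Type} : Prog T A α → (α → Prog T A β) → Prog T A β
  | .ret a, f => f a
  | .test t q, f => .test t fun b => Prog.bind (q b) f
  | .act a q, f => .act a (Prog.bind q f)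

instance {T A : Type} : Monad (Prog T A) where
  pure := Prog.ret
  bind := Prog.bind

/-- The program that asks one test and returns the answer. -/
def ask {T A : Type} (t : T) : Prog T A Bool := .test t fun b => .ret b

/-- The program that performs one action. -/
def perform {T A : Type} (a : A) : Prog T A Unit := .act a (.ret ())

/-- A machine with state space `σ`: how it answers the tests and performs the actions. -/
structure Machine (T A σ : Type) where
  onTest : T → σ → Bool × σ
  onAct : A → σ → σ

/-- The result of a run: returned value, final state, number of tests, list of actions. -/
structure Outcome (A σ α : Type) where
  value : α
  state : σ
  tests : ℕ
  acts : List A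

/-- Running a program on a machine from a given state. -/
def Machine.run {T A σ α : Type} (m : Machine T A σ) : Prog T A α → σ → Outcome A σ α
  | .ret a, s => ⟨a, s, 0, []⟩
  | .test t q, s =>
      let o := m.run (q (m.onTest t s).1) (m.onTest t s).2
      ⟨o.value, o.state, o.tests + 1, o.acts⟩
  | .act a q, s =>
      let o := m.run q (m.onAct a s)
      ⟨o.value, o.state, o.tests, a :: o.acts⟩

/-- Binary search. If the tests `t base, …, t (base + n - 1)` are first all true, then all false,
it returns `base +` the number of true ones. -/
def bisect {T A : Type} (t : ℕ → T) (n base : ℕ) : Prog T A ℕ :=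
  if n = 0 then .ret base
  else .test (t (base + n / 2)) fun b =>
    if b then bisect t (n - n / 2 - 1) (base + n / 2 + 1) else bisect t (n / 2) base
termination_by n
decreasing_by all_goals omega

/-! ## Scales, concave cover, kept indices -/

noncomputable section

/-- The integer `1 + ⌊log₂ |z|⌋`, meaningful for `z ≠ 0`. -/
def scaleInt (z : ℂ) : ℤ := 1 + ⌊Real.logb 2 ‖z‖⌋

open Classical in
/-- The scale `s(z) = 1 + ⌊log₂ |z|⌋` of a complex number, with `s(0) = -∞`. -/
def scale (z : ℂ) : EReal := if z = 0 then ⊥ else ((scaleInt z : ℝ) : EReal)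

/-- The concave cover of the scales of the coefficients of `P`: the smallest concave function on
`[0, deg P]` that is at least `s(a_k)` at each integer `k`. -/
def concaveCover (P : ℂ[X]) (x : ℝ) : ℝ :=
  sInf {y : ℝ | ∃ f : ℝ → ℝ, ConcaveOn ℝ (Set.Icc 0 (P.natDegree : ℝ)) f ∧
    (∀ k ≤ P.natDegree, scale (P.coeff k) ≤ ((f k : ℝ) : EReal)) ∧ f x = y}

/-- The thickness `p + s(d) + 3` of the strip. -/
def thickness (d p : ℕ) : ℝ := (p : ℝ) + (scaleInt (d : ℂ) : ℝ) + 3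

open Classical in
/-- The good indices `G_p`: those `k` with `s(a_k) ≥ Ê_P(k) - p - s(d) - 3`. -/
def goodIndices (P : ℂ[X]) (p : ℕ) : Finset ℕ :=
  (Finset.range (P.natDegree + 1)).filter fun k =>
    ((concaveCover P k - thickness P.natDegree p : ℝ) : EReal) ≤ scale (P.coeff k)

open Classical in
/-- The integer interval `⟦ℓ, r⟧` for the point `z`: with `λ = log₂ |z|`, the indices `k` with
`Ê_P(k) + λ k ≥ max (Ê_P + λ Id) - p - s(d) - 3`, the maximum being over `[0, d]`. -/
def window (P : ℂ[X]) (p : ℕ) (z : ℂ) : Finset ℕ :=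
  (Finset.range (P.natDegree + 1)).filter fun k =>
    ∀ x ∈ Set.Icc (0 : ℝ) (P.natDegree : ℝ),
      concaveCover P x + Real.logb 2 ‖z‖ * x - thickness P.natDegree p
        ≤ concaveCover P k + Real.logb 2 ‖z‖ * k

/-- The reduced polynomial at `z`: the sum of `a_k z^k` over `k ∈ G_p ∩ ⟦ℓ, r⟧`. -/
def reducedValue (P : ℂ[X]) (p : ℕ) (z : ℂ) : ℂ :=
  ∑ k ∈ goodIndices P p ∩ window P p z, P.coeff k * z ^ k

end

/-! ## Preconditioning phase -/

/-- The tests of the preconditioning phase. Each compares two machine numbers, one of which may be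
the height at one abscissa of a line given by two points; it costs one operation. The scales of the
coefficients are read off at no cost, and the handling of indices is not counted.
* `scaleLE i j`: is `s(a_i) ≤ s(a_j)`?
* `notBelow i j k`: is the point `(k, s(a_k))` on or above the line through the points `i`, `j`?
* `good i j k`: store the height at `k` of the line through the points `i`, `j`; is `s(a_k)` at
  least this height minus the thickness of the strip? -/
inductive PreTest : Type
  | scaleLE (i j : ℕ)
  | notBelow (i j k : ℕ)
  | good (i j k : ℕ)

/-- An action `n` of a preconditioning program records that `n` words of working memory are in use;
it takes no time. -/
abbrev PreProg := Prog PreTest ℕ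

/-- Merging two sorted lists of indices (decreasing scales; in case of equality the left list
goes first). -/
def merge : List ℕ → List ℕ → PreProg (List ℕ)
  | [], ys => .ret ys
  | x :: xs, [] => .ret (x :: xs)
  | x :: xs, y :: ys => .test (.scaleLE y x) fun b =>
      if b then do
        let l ← merge xs (y :: ys)
        return x :: l
      else do
        let l ← merge (x :: xs) ys
        return y :: l
termination_by xs ys => xs.length + ys.length

/-- Merge sort of a list of indices by decreasing scale; `outer` is the number of words in use
outside the list that is being sorted. -/
def mergeSort (outer : ℕ) (l : List ℕ) : PreProg (List ℕ) :=
  if l.length ≤ 1 then .ret l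
  else do
    let xs ← mergeSort (outer + (l.drop (l.length / 2)).length) (l.take (l.length / 2))
    let ys ← mergeSort (outer + (l.take (l.length / 2)).length) (l.drop (l.length / 2))
    perform (outer + 2 * l.length)
    merge xs ys
termination_by l.length
decreasing_by
  · simp only [List.length_take]; omega
  · simp only [List.length_drop]; omega

/-- Adding the index `k` to a chain of vertices beyond its first element: a binary search finds how
many segments have to be removed, namely those whose line does not pass above `(k, s(a_k))`. -/
def extend (c : List ℕ) (k : ℕ) : PreProg (List ℕ) := do
  let i ← bisect (fun j => PreTest.notBelow (c.getD j 0) (c.getD (j + 1) 0) k) (c.length - 1) 0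
  return k :: c.drop i

/-- Adding the index `k` to the list of vertices of the current concave map (from left to right). -/
def insertVertex (c : List ℕ) (k : ℕ) : PreProg (List ℕ) :=
  if k < c.headD (k + 1) then extend c k
  else if c.getLastD 0 < k then do
    let c' ← extend c.reverse k
    return c'.reverse
  else .ret c

/-- Construction of the concave cover, adding the indices one by one. -/
def buildHull : List ℕ → List ℕ → PreProg (List ℕ)
  | c, [] => .ret c
  | c, k :: ks => do
      perform ((k :: ks).length + c.length + 1)
      let c' ← insertVertex c k
      buildHull c' ks

/-- The good ones among the indices of a list lying between two consecutive vertices `i`, `j`. -/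
def scanGap (i j : ℕ) : List ℕ → PreProg (List ℕ)
  | [] => .ret []
  | k :: ks => do
      let b ← ask (PreTest.good i j k)
      let l ← scanGap i j ks
      return if b then k :: l else l

/-- The list of all good indices; the vertices of the concave cover are good without a test. -/
def scan : List ℕ → PreProg (List ℕ)
  | [] => .ret []
  | [i] => .ret [i]
  | i :: j :: c => do
      let l ← scanGap i j ((List.range j).filter fun k => i < k)
      let l' ← scan (j :: c)
      return i :: (l ++ l')

/-- The discrete part of a preconditioned polynomial: the degree, the vertices of the concave cover
and the good indices, both from left to right. -/
structure Data where
  degree : ℕ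
  verts : List ℕ
  good : List ℕ

/-- The preconditioning phase for polynomials of degree `d`. -/
def precondition (d : ℕ) : PreProg Data := do
  let order ← mergeSort 0 (List.range (d + 1))
  let verts ← buildHull [] order
  let good ← scan verts
  perform (verts.length + good.length)
  return ⟨d, verts, good⟩

noncomputable section

/-- The height at abscissa `k` of the line through the points `(i, h i)` and `(j, h j)`. -/
def lineHeight (h : ℕ → ℝ) (i j k : ℕ) : ℝ :=
  h i + (h j - h i) / ((j : ℝ) - (i : ℝ)) * ((k : ℝ) - (i : ℝ))

open Classical in
/-- The preconditioning machine for the coefficients `a` and the strip thickness `τ`. Its state is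
the table of heights. -/
def preMachine (a : ℕ → ℂ) (τ : ℝ) : Machine PreTest ℕ (ℕ → ℝ) where
  onTest
    | .scaleLE i j, h => (decide (scale (a i) ≤ scale (a j)), h)
    | .notBelow i j k, h => (decide ((lineHeight h i j k : EReal) ≤ scale (a k)), h)
    | .good i j k, h =>
        (decide (((lineHeight h i j k - τ : ℝ) : EReal) ≤ scale (a k)),
          Function.update h k (lineHeight h i j k))
  onAct _ h := h

/-- The run of the preconditioning phase on `P` at precision `p`; initially the table of heights
contains the scales of the nonzero coefficients. -/
def preRun (P : ℂ[X]) (p : ℕ) : Outcome ℕ (ℕ → ℝ) Data :=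
  (preMachine P.coeff (thickness P.natDegree p)).run (precondition P.natDegree)
    fun k => (scaleInt (P.coeff k) : ℝ)

/-- Number of operations of the preconditioning phase. -/
def preTime (P : ℂ[X]) (p : ℕ) : ℕ := (preRun P p).tests

/-- Memory (in bits) of the preconditioning phase on machine words of `w` bits: `d + 1` complex
coefficients, each made of two signed `p`-bit mantissas and two exponents (one word each), the
tables of scales and of heights (`d + 1` words each), and the peak working memory. -/
def preMemory (w : ℕ) (P : ℂ[X]) (p : ℕ) : ℕ :=
  2 * (P.natDegree + 1) * (p + 1)
    + w * (4 * (P.natDegree + 1) + (preRun P p).acts.foldr max 0)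

end

/-! ## Evaluation phase -/

/-- The tests of the evaluation phase; they use the registers `lam` (for `λ`) and `top` (for `N`).
Each assigns at most one register and then makes one comparison of two machine numbers given by
expressions of bounded size; it costs one operation.
* `setScale i j`: let `lam = log₂ |z|`, then as `slope i j`;
* `slope i j`: is `-lam` less than the slope of the line through the points `i`, `j` of `Ê_P`?
* `setTop k`: let `top = Ê_P(k) + lam * k`; is `top - τ ≤ Ê_P(0)`?
* `inStrip i`: is `top - τ ≤ Ê_P(i) + lam * i`?
* `outStrip i`: the negation of `inStrip i`. -/
inductive EvalTest : Type
  | setScale (i j : ℕ)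
  | slope (i j : ℕ)
  | setTop (k : ℕ)
  | inStrip (i : ℕ)
  | outStrip (i : ℕ)

/-- Operands of the high precision arithmetic: the number zero, the evaluation point, the
coefficients, and two registers. -/
inductive Operand : Type
  | zero
  | point
  | coef (k : ℕ)
  | acc
  | pow

/-- The actions of the evaluation phase: one multiplication followed by one addition `x * y + u` at
precision `p`, the result being put into the register `acc` or `pow`. -/
inductive EvalAct : Type
  | toAcc (x y u : Operand)
  | toPow (x y u : Operand)

abbrev EvalProg := Prog EvalTest EvalAct

/-- The argument of the maximum of `Ê_P + λ Id` by binary search on the slopes between consecutive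
vertices; the first step also computes `λ`. -/
def findTop (v : List ℕ) : EvalProg ℕ := do
  let m := v.length - 1
  let j ← (if m = 0 then .ret 0 else
    .test (.setScale (v.getD (m / 2) 0) (v.getD (m / 2 + 1) 0)) fun b =>
      let t := fun j => EvalTest.slope (v.getD j 0) (v.getD (j + 1) 0)
      if b then bisect t (m - m / 2 - 1) (m / 2 + 1) else bisect t (m / 2) 0)
  return v.getD j 0

/-- The left edge `ℓ`, for `k` the argument of the maximum. The first test also computes `N`
(nothing has to be computed for `k = 0`). -/
def findLeft (k : ℕ) : EvalProg ℕ :=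
  if k = 0 then .ret 0
  else .test (.setTop k) fun b => if b then .ret 0 else bisect EvalTest.outStrip (k - 1) 1

/-- The right edge `r`. -/
def findRight (d k : ℕ) : EvalProg ℕ := do
  let i ← bisect EvalTest.inStrip (d - k) (k + 1)
  return i - 1

/-- The operand for the coefficient `k` of the reduced polynomial. -/
def term (G : List ℕ) (k : ℕ) : Operand := if k ∈ G then .coef k else .zero

/-- Hörner's method: `horner G l n x` computes `x * z ^ n + ∑ i < n, b_{l+i} * z ^ i`, where `b` are
the coefficients with index in `G`; the result is in the returned operand. -/
def horner (G : List ℕ) (l : ℕ) : ℕ → Operand → EvalProg Operand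
  | 0, x => .ret x
  | n + 1, x => .act (.toAcc x .point (term G (l + n))) (horner G l n .acc)

/-- Computation of `z ^ n` for `n ≥ 1` by repeated squaring. -/
def power (n : ℕ) : EvalProg Operand :=
  if n ≤ 1 then .ret .point
  else do
    let x ← power (n / 2)
    perform (.toPow x x .zero)
    if n % 2 = 1 then perform (.toPow .pow .point .zero)
    return .pow
termination_by n
decreasing_by omega

/-- Computation of the reduced polynomial `∑ a_k z ^ k` over the `k` in `G` with `l ≤ k ≤ r`. -/
def evalReduced (G : List ℕ) (l r : ℕ) : EvalProg Operand := do
  let x ← horner G l (r - l) (term G r)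
  if l = 0 then return x
  else do
    let y ← power l
    perform (.toAcc x y .zero)
    return .acc

/-- The evaluation phase. -/
def evaluation (D : Data) : EvalProg Operand := do
  let k ← findTop D.verts
  let l ← findLeft k
  let r ← findRight D.degree k
  evalReduced D.good l r

noncomputable section

/-- The high precision arithmetic: how numbers are read (rounding) and the, possibly inexact,
multiplication followed by an addition, `x, y, u ↦ x * y + u`. -/
structure Arithmetic where
  read : ℂ → ℂ
  mulAdd : ℂ → ℂ → ℂ → ℂ

/-- Exact arithmetic. -/
def Arithmetic.exact : Arithmetic where
  read := id
  mulAdd x y u := x * y + u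

/-- The state of the evaluation machine. -/
structure EvalState where
  lam : ℝ
  top : ℝ
  acc : ℂ
  pow : ℂ

/-- The value of an operand, for the coefficients `a` and the evaluation point `z`. -/
def Operand.value (F : Arithmetic) (a : ℕ → ℂ) (z : ℂ) (s : EvalState) : Operand → ℂ
  | .zero => 0
  | .point => F.read z
  | .coef k => F.read (a k)
  | .acc => s.acc
  | .pow => s.pow

open Classical in
/-- The evaluation machine, for the coefficients `a`, the heights `h` of the concave cover, the
strip thickness `τ` and the evaluation point `z`. -/
def evalMachine (F : Arithmetic) (a : ℕ → ℂ) (h : ℕ → ℝ) (τ : ℝ) (z : ℂ) :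
    Machine EvalTest EvalAct EvalState where
  onTest
    | .setScale i j, s =>
        (decide (-(Real.logb 2 ‖z‖) < (h j - h i) / ((j : ℝ) - (i : ℝ))),
          { s with lam := Real.logb 2 ‖z‖ })
    | .slope i j, s => (decide (-s.lam < (h j - h i) / ((j : ℝ) - (i : ℝ))), s)
    | .setTop k, s => (decide (h k + s.lam * k - τ ≤ h 0), { s with top := h k + s.lam * k })
    | .inStrip i, s => (decide (s.top - τ ≤ h i + s.lam * i), s)
    | .outStrip i, s => (decide (¬ s.top - τ ≤ h i + s.lam * i), s)
  onAct
    | .toAcc x y u, s =>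
        { s with acc := F.mulAdd (x.value F a z s) (y.value F a z s) (u.value F a z s) }
    | .toPow x y u, s =>
        { s with pow := F.mulAdd (x.value F a z s) (y.value F a z s) (u.value F a z s) }

/-- The run of the evaluation phase at `z` on the preconditioned polynomial; the register `top`
initially contains the stored value `Ê_P(0)`. -/
def evalRun (F : Arithmetic) (P : ℂ[X]) (p : ℕ) (z : ℂ) : Outcome EvalAct EvalState Operand :=
  (evalMachine F P.coeff (preRun P p).state (thickness P.natDegree p) z).run
    (evaluation (preRun P p).value) ⟨0, (preRun P p).state 0, 0, 0⟩

/-- The number that the evaluation phase outputs. -/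
def evalOutput (F : Arithmetic) (P : ℂ[X]) (p : ℕ) (z : ℂ) : ℂ :=
  (evalRun F P p z).value.value F P.coeff z (evalRun F P p z).state

/-- Evaluation time when one high precision multiplication-addition takes time `m`. -/
def evalTime (F : Arithmetic) (P : ℂ[X]) (p : ℕ) (m : ℝ) (z : ℂ) : ℝ :=
  ((evalRun F P p z).tests : ℝ) + ((evalRun F P p z).acts.length : ℝ) * m

/-- The uniform probability measure on the Riemann sphere in the affine coordinate `z`, of density
`1 / (π (1 + |z|²)²)`; the point at infinity has measure zero. -/
def sphereMeasure : Measure ℂ :=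
  volume.withDensity fun z => ENNReal.ofReal (1 / (Real.pi * (1 + ‖z‖ ^ 2) ^ 2))

/-- The uniform probability measure on the circle `ℝ ∪ {∞}` in the affine coordinate `x`, of density
`1 / (π (1 + x²))`; the point at infinity has measure zero. -/
def circleMeasure : Measure ℝ :=
  volume.withDensity fun x => ENNReal.ofReal (1 / (Real.pi * (1 + x ^ 2)))

end

end FPE

/-!
The correctness of the preconditioning phase rests on one invariant (`FPE.IsChain`): the line
through any two consecutive members of the current list of vertices is nowhere below a scale that
has been treated. Such a line is a concave majorant of the scales, and every concave majorant is
above it between the two members; so, at the end, these lines are the pieces of the concave cover,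
and nothing else about convexity is needed. The invariant survives the insertion of a point beyond
an end of the list (`FPE.IsChain.extend`) because the new line lies above the lines of the last
removed and of the first remaining segment. A point between the ends needs no action, since the
indices come in the order of decreasing scales. A binary search returns a position where its tests
change from true to false (`FPE.run_bisect`), and this local information suffices each time: here,
for the maximum of `Ê_P + λ Id`, and for the edges of the window.

For the time of preconditioning, merge sort of `d + 1` indices and the binary searches in chains of
at most `0, 1, …, d - 1` segments both cost sums of the form `∑ (1 + ⌊log₂ i⌋)`, with the closed form
`n c - 2 ^ c + 1`; the scan adds at most `d - 1`, and the total is compared with `d + 2 d log₂ d` by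
concavity of the logarithm between consecutive powers of two.

The average evaluation time is governed by the length `r - ℓ` of the window. Let `g(λ)` be the
maximum of `Ê_P + λ Id`. Comparing `g(λ + δ)` with the value at `r` and `g(λ - δ)` with the value
at `ℓ` gives `δ (r - ℓ) ≤ g(λ + δ) + g(λ - δ) - 2 g(λ) + 2 τ` (`FPE.window_length_le`). Since the
slopes of `g` are in `[0, d]`, this second difference is nonnegative and has integral at most `d δ²`
over `ℝ` (`FPE.lintegral_second_difference_le`). If the density of `λ = log₂ |z|` is at most `c`, the
mean length is thus at most `2 τ / δ + c d δ`, which is `2 √(2 c d τ)` for the best `δ`. On the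
sphere `c = log 2 / 2`, on the circle `c = log 2 / π`, and the resulting constants are below `1.9046`
and `1.7673` with a margin that pays for the multiplication by `z ^ ℓ` when `d ≥ 16`; for smaller
degrees the worst case is already below the claimed average.
-/

namespace FPE

noncomputable section

/-! ### Runs of programs -/

section Run

variable {T A σ α β : Type}

@[simp] theorem run_ret (m : Machine T A σ) (a : α) (s : σ) :
    m.run (.ret a) s = ⟨a, s, 0, []⟩ := rfl

@[simp] theorem run_pure (m : Machine T A σ) (a : α) (s : σ) :
    m.run (pure a) s = ⟨a, s, 0, []⟩ := rfl

theorem run_test (m : Machine T A σ) (t : T) (q : Bool → Prog T A α) (s : σ) :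
    m.run (.test t q) s =
      ⟨(m.run (q (m.onTest t s).1) (m.onTest t s).2).value,
        (m.run (q (m.onTest t s).1) (m.onTest t s).2).state,
        (m.run (q (m.onTest t s).1) (m.onTest t s).2).tests + 1,
        (m.run (q (m.onTest t s).1) (m.onTest t s).2).acts⟩ := rfl

theorem run_act (m : Machine T A σ) (a : A) (q : Prog T A α) (s : σ) :
    m.run (.act a q) s =
      ⟨(m.run q (m.onAct a s)).value, (m.run q (m.onAct a s)).state,
        (m.run q (m.onAct a s)).tests, a :: (m.run q (m.onAct a s)).acts⟩ := rfl

theorem run_bind (m : Machine T A σ) (q : Prog T A α) (f : α → Prog T A β) (s : σ) :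
    m.run (q >>= f) s =
      ⟨(m.run (f (m.run q s).value) (m.run q s).state).value,
        (m.run (f (m.run q s).value) (m.run q s).state).state,
        (m.run q s).tests + (m.run (f (m.run q s).value) (m.run q s).state).tests,
        (m.run q s).acts ++ (m.run (f (m.run q s).value) (m.run q s).state).acts⟩ := by
  induction q generalizing s with
  | ret a => simp [Bind.bind, Prog.bind]
  | test t q ih =>
    have := ih (m.onTest t s).1 (m.onTest t s).2
    simp only [Bind.bind, Prog.bind, run_test] at this ⊢
    rw [this]
    simp [Nat.add_right_comm]
  | act a q ih =>
    have := ih (m.onAct a s)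
    simp only [Bind.bind, Prog.bind, run_act] at this ⊢
    rw [this]
    simp

theorem run_ask (m : Machine T A σ) (t : T) (s : σ) :
    m.run (ask t) s = ⟨(m.onTest t s).1, (m.onTest t s).2, 1, []⟩ := rfl

theorem run_perform (m : Machine T A σ) (a : A) (s : σ) :
    m.run (perform a : Prog T A Unit) s = ⟨(), m.onAct a s, 0, [a]⟩ := rfl

/-- Binary search without any monotonicity of the tests: the returned position is preceded by a
test that succeeds and followed by one that fails, unless it is an end of the range. Monotonicity
is needed only to extend these local facts to the remaining positions. -/
theorem run_bisect (m : Machine T A σ) (s : σ) (t : ℕ → T)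
    (hs : ∀ j, (m.onTest (t j) s).2 = s) (n base : ℕ) :
    (m.run (bisect t n base) s).state = s ∧
    (m.run (bisect t n base) s).acts = [] ∧
    (m.run (bisect t n base) s).tests ≤ n.size ∧
    base ≤ (m.run (bisect t n base) s).value ∧
    (m.run (bisect t n base) s).value ≤ base + n ∧
    ((m.run (bisect t n base) s).value = base ∨
      (m.onTest (t ((m.run (bisect t n base) s).value - 1)) s).1 = true) ∧
    ((m.run (bisect t n base) s).value = base + n ∨
      (m.onTest (t (m.run (bisect t n base) s).value) s).1 = false) := by
  induction n using Nat.strong_induction_on generalizing base with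
  | _ n ih =>
    rw [bisect]
    split_ifs with hn
    · simp [hn]
    · have hsize : (n / 2).size + 1 ≤ n.size := by
        have h0 : 0 < n.size := Nat.size_pos.2 (Nat.pos_of_ne_zero hn)
        have h1 : n < 2 ^ n.size := Nat.size_le.1 le_rfl
        have h2 : (n / 2).size ≤ n.size - 1 := by
          rw [Nat.size_le]
          have : 2 ^ n.size = 2 * 2 ^ (n.size - 1) := by
            rw [← pow_succ', Nat.sub_add_cancel h0]
          omega
        omega
      simp only [run_test, hs]
      cases hb : (m.onTest (t (base + n / 2)) s).1 with
      | true =>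
        obtain ⟨h1, h2, h3, h4, h5, h6, h7⟩ :=
          ih (n - n / 2 - 1) (by omega) (base + n / 2 + 1)
        simp only [if_true]
        refine ⟨h1, h2, ?_, by omega, by omega, ?_, ?_⟩
        · have := Nat.size_le_size (show n - n / 2 - 1 ≤ n / 2 by omega)
          omega
        · right
          rcases h6 with h6 | h6
          · rw [h6, Nat.add_sub_cancel, hb]
          · exact h6
        · rcases h7 with h7 | h7
          · left; omega
          · exact Or.inr h7
      | false =>
        obtain ⟨h1, h2, h3, h4, h5, h6, h7⟩ := ih (n / 2) (by omega) base
        simp only [Bool.false_eq_true, if_false]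
        refine ⟨h1, h2, by omega, h4, by omega, h6, ?_⟩
        right
        rcases h7 with h7 | h7
        · rw [h7, hb]
        · exact h7

end Run

/-! ### Merge sort -/

theorem run_merge (a : ℕ → ℂ) (τ : ℝ) (h : ℕ → ℝ) (xs ys : List ℕ) :
    ((preMachine a τ).run (merge xs ys) h).state = h ∧
    ((preMachine a τ).run (merge xs ys) h).acts = [] ∧
    ((preMachine a τ).run (merge xs ys) h).tests ≤ xs.length + ys.length - 1 ∧
    ((preMachine a τ).run (merge xs ys) h).value.Perm (xs ++ ys) ∧
    (xs.Pairwise (fun i j => scale (a j) ≤ scale (a i)) →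
      ys.Pairwise (fun i j => scale (a j) ≤ scale (a i)) →
      ((preMachine a τ).run (merge xs ys) h).value.Pairwise
        fun i j => scale (a j) ≤ scale (a i)) := by
  induction xs, ys using merge.induct with
  | case1 ys => simp [merge]
  | case2 x xs => simp [merge]
  | case3 x xs y ys ih1 ih2 =>
    rw [merge]
    simp only [run_test, preMachine]
    by_cases hb : scale (a y) ≤ scale (a x)
    · obtain ⟨h1, h2, h3, h4, h5⟩ := ih1
      simp only [preMachine] at h1 h2 h3 h4 h5
      simp only [hb, decide_true, if_true, run_bind, run_pure, h1, h2]
      refine ⟨trivial, rfl, ?_, ?_, ?_⟩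
      · simp only [List.length_cons] at h3 ⊢; omega
      · exact (h4.cons x)
      · intro hx hy
        rw [List.pairwise_cons] at hx ⊢
        refine ⟨fun j hj => ?_, h5 hx.2 hy⟩
        rcases List.mem_append.1 (h4.subset hj) with hj | hj
        · exact hx.1 j hj
        · rcases List.mem_cons.1 hj with rfl | hj
          · exact hb
          · exact ((List.pairwise_cons.1 hy).1 j hj).trans hb
    · obtain ⟨h1, h2, h3, h4, h5⟩ := ih2
      simp only [preMachine] at h1 h2 h3 h4 h5
      simp only [hb, decide_false, Bool.false_eq_true, if_false, run_bind, run_pure, h1, h2]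
      refine ⟨trivial, rfl, ?_, ?_, ?_⟩
      · simp only [List.length_cons] at h3 ⊢; omega
      · exact (h4.cons y).trans List.perm_middle.symm
      · intro hx hy
        have hb' := (not_le.1 hb).le
        rw [List.pairwise_cons] at hy ⊢
        refine ⟨fun j hj => ?_, h5 hx hy.2⟩
        rcases List.mem_append.1 (h4.subset hj) with hj | hj
        · rcases List.mem_cons.1 hj with rfl | hj
          · exact hb'
          · exact ((List.pairwise_cons.1 hx).1 j hj).trans hb'
        · exact hy.1 j hj

/-- Merge sort of `n` indices makes at most `∑ i ≤ n, ⌈log₂ i⌉` comparisons; that sum is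
`n c - 2 ^ c + 1` for any `c` with `n ≤ 2 ^ c ≤ 2 n`. -/
theorem run_mergeSort (a : ℕ → ℂ) (τ : ℝ) (h : ℕ → ℝ) (outer : ℕ) (l : List ℕ) :
    ((preMachine a τ).run (mergeSort outer l) h).state = h ∧
    (∀ n ∈ ((preMachine a τ).run (mergeSort outer l) h).acts, n ≤ outer + 2 * l.length) ∧
    (∀ c, 1 ≤ l.length → l.length ≤ 2 ^ c → 2 ^ c ≤ 2 * l.length →
      ((preMachine a τ).run (mergeSort outer l) h).tests + 2 ^ c ≤ l.length * c + 1) ∧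
    ((preMachine a τ).run (mergeSort outer l) h).value.Perm l ∧
    ((preMachine a τ).run (mergeSort outer l) h).value.Pairwise
      (fun i j => scale (a j) ≤ scale (a i)) := by
  induction outer, l using mergeSort.induct with
  | case1 outer l hl =>
    rw [mergeSort, if_pos hl]
    refine ⟨rfl, by simp, ?_, List.Perm.refl _, ?_⟩
    · intro c h1 h2 h3
      have hl1 : l.length = 1 := by omega
      rw [hl1] at h3 ⊢
      have : c ≤ 1 := by
        by_contra hc
        have := Nat.pow_le_pow_right (show 0 < 2 by norm_num) (show 2 ≤ c by omega)
        omega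
      interval_cases c <;> simp
    · match l, hl with
      | [], _ => simp
      | [x], _ => simp
  | case2 outer l hl ih1 ih2 =>
    rw [mergeSort, if_neg hl]
    obtain ⟨s1, m1, t1, p1, o1⟩ := ih1
    obtain ⟨s2, m2, t2, p2, o2⟩ := ih2
    have act : ∀ n, (preMachine a τ).onAct n h = h := fun n => rfl
    simp only [run_bind, s1, s2, run_perform, act]
    obtain ⟨s3, m3, t3, p3, o3⟩ := run_merge a τ h
      ((preMachine a τ).run (mergeSort (outer + (l.drop (l.length / 2)).length)
        (l.take (l.length / 2))) h).value
      ((preMachine a τ).run (mergeSort (outer + (l.take (l.length / 2)).length)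
        (l.drop (l.length / 2))) h).value
    have lt : (l.take (l.length / 2)).length = l.length / 2 := by
      rw [List.length_take]; omega
    have ld : (l.drop (l.length / 2)).length = l.length - l.length / 2 := List.length_drop
    refine ⟨s3, ?_, ?_, ?_, o3 o1 o2⟩
    · intro n hn
      simp only [m3, List.mem_append, List.mem_cons, List.not_mem_nil, or_false] at hn
      rcases hn with hn | hn | hn
      · have := m1 n hn; omega
      · have := m2 n hn; omega
      · exact hn.le
    · intro c h1 h2 h3
      obtain ⟨c, rfl⟩ : ∃ c', c = c' + 1 := by
        refine ⟨c - 1, ?_⟩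
        rcases c with _ | c
        · simp at h2; omega
        · rfl
      rw [p1.length_eq, p2.length_eq] at t3
      have e : 2 ^ (c + 1) = 2 * 2 ^ c := pow_succ' 2 c
      have ec : 2 ^ c ≤ 2 * (l.length / 2) := by
        rcases c with _ | c
        · simp; omega
        · rw [pow_succ'] at *; omega
      have t1' := t1 c (by omega) (by omega) (by omega)
      have t2' := t2 c (by omega) (by omega) (by omega)
      have e1 : (l.take (l.length / 2)).length * c = l.length / 2 * c := by rw [lt]
      have e2 : (l.drop (l.length / 2)).length * c = (l.length - l.length / 2) * c := by rw [ld]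
      have key : l.length / 2 * c + (l.length - l.length / 2) * c = l.length * c := by
        rw [← add_mul]; congr 1; omega
      have : l.length * (c + 1) = l.length * c + l.length := by ring
      omega
    · exact p3.trans ((p1.append p2).trans (by rw [List.take_append_drop]))

/-! ### Lines through two points -/

/-- The affine function through the points `(i, h i)` and `(j, h j)`, on the real line. -/
def line (h : ℕ → ℝ) (i j : ℕ) (x : ℝ) : ℝ :=
  h i + (h j - h i) / ((j : ℝ) - (i : ℝ)) * (x - (i : ℝ))

theorem lineHeight_eq (h : ℕ → ℝ) (i j k : ℕ) : lineHeight h i j k = line h i j k := rfl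

theorem line_left (h : ℕ → ℝ) (i j : ℕ) : line h i j i = h i := by simp [line]

theorem line_right (h : ℕ → ℝ) {i j : ℕ} (hij : i ≠ j) : line h i j j = h j := by
  have : (j : ℝ) - i ≠ 0 := sub_ne_zero.2 (by exact_mod_cast hij.symm)
  rw [line, div_mul_cancel₀ _ this]; ring

theorem line_swap (h : ℕ → ℝ) {i j : ℕ} (hij : i ≠ j) (x : ℝ) : line h i j x = line h j i x := by
  have h1 : (j : ℝ) - i ≠ 0 := sub_ne_zero.2 (by exact_mod_cast hij.symm)
  have h2 : (i : ℝ) - j ≠ 0 := sub_ne_zero.2 (by exact_mod_cast hij)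
  rw [line, line]
  field_simp
  ring

theorem line_eq_interpolation (h : ℕ → ℝ) (i j : ℕ) {u v : ℝ} (huv : u ≠ v) (t : ℝ) :
    line h i j t = line h i j u + (t - u) / (v - u) * (line h i j v - line h i j u) := by
  have : v - u ≠ 0 := sub_ne_zero.2 huv.symm
  simp only [line]
  field_simp
  ring

theorem line_congr {h h' : ℕ → ℝ} {i j : ℕ} (hi : h i = h' i) (hj : h j = h' j) (x : ℝ) :
    line h i j x = line h' i j x := by
  simp only [line, hi, hj]

/-- If `u` separates `t` from `v`, then an inequality between two lines at `u` which is reversed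
at `v` persists at `t`. -/
theorem line_le_of_opposite (h : ℕ → ℝ) {i j i' j' : ℕ} {u v t : ℝ} (huv : u ≠ v)
    (side : (t - u) * (v - u) ≤ 0) (hu : line h i j u ≤ line h i' j' u)
    (hv : line h i' j' v ≤ line h i j v) : line h i j t ≤ line h i' j' t := by
  rw [line_eq_interpolation h i j huv, line_eq_interpolation h i' j' huv]
  have hs : (t - u) / (v - u) ≤ 0 := by
    rw [div_eq_mul_inv]
    have : (t - u) * (v - u)⁻¹ = (t - u) * (v - u) * ((v - u)⁻¹ * (v - u)⁻¹) := by
      have : v - u ≠ 0 := sub_ne_zero.2 huv.symm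
      field_simp
    rw [this]
    exact mul_nonpos_of_nonpos_of_nonneg side (mul_self_nonneg _)
  nlinarith

/-- Two lines that meet at `u` keep their order on each side of `u`. -/
theorem line_le_of_same (h : ℕ → ℝ) {i j i' j' : ℕ} {u v t : ℝ} (huv : u ≠ v)
    (side : 0 ≤ (t - u) * (v - u)) (hu : line h i j u = line h i' j' u)
    (hv : line h i j v ≤ line h i' j' v) : line h i j t ≤ line h i' j' t := by
  rw [line_eq_interpolation h i j huv, line_eq_interpolation h i' j' huv, hu]
  have hs : 0 ≤ (t - u) / (v - u) := by
    rw [div_eq_mul_inv]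
    have : (t - u) * (v - u)⁻¹ = (t - u) * (v - u) * ((v - u)⁻¹ * (v - u)⁻¹) := by
      have : v - u ≠ 0 := sub_ne_zero.2 huv.symm
      field_simp
    rw [this]
    exact mul_nonneg side (mul_self_nonneg _)
  nlinarith

/-- A line that is at least `y` at both ends of an interval is at least `y` on the interval. -/
theorem le_line_of_between (h : ℕ → ℝ) {i j : ℕ} {u v t y : ℝ} (h1 : u ≤ t) (h2 : t ≤ v)
    (hu : y ≤ line h i j u) (hv : y ≤ line h i j v) : y ≤ line h i j t := by
  rcases (h1.trans h2).eq_or_lt with huv | huv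
  · rwa [← le_antisymm h1 (h2.trans huv.symm.le)]
  · have hl : line h i j t * (v - u) = line h i j u * (v - t) + line h i j v * (t - u) := by
      simp only [line]; ring
    have : y * (v - u) ≤ line h i j t * (v - u) := by
      rw [hl]; nlinarith
    exact le_of_mul_le_mul_right this (by linarith)

/-! ### The chain of vertices -/

/-- The scales as real numbers, as initially stored in the table of heights. At a zero coefficient the
value is meaningless; such an index never becomes a vertex. -/
def heights (a : ℕ → ℂ) (k : ℕ) : ℝ := (scaleInt (a k) : ℝ)

theorem scale_eq_heights {a : ℕ → ℂ} {k : ℕ} (hk : a k ≠ 0) :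
    scale (a k) = ((heights a k : ℝ) : EReal) := by
  rw [scale, if_neg hk, heights]

/-- The list `c` consists of the successive vertices of the concave cover of the scales of the
coefficients with index in `S`: it goes from one end of `S` to the other, and the line through any
two consecutive members is nowhere on `S` below a scale. It goes from left to right if `σ = 1` and
from right to left if `σ = -1`. -/
structure IsChain (a : ℕ → ℂ) (σ : ℝ) (S : Set ℕ) (c : List ℕ) : Prop where
  nonempty : 0 < c.length ∨ S = ∅
  sorted : ∀ i j, i < j → j < c.length → σ * c.getD i 0 < σ * c.getD j 0
  mem : ∀ j < c.length, c.getD j 0 ∈ S ∧ a (c.getD j 0) ≠ 0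
  head : ∀ t ∈ S, σ * c.getD 0 0 ≤ σ * t
  last : ∀ t ∈ S, σ * t ≤ σ * c.getD (c.length - 1) 0
  le_line : ∀ j, j + 1 < c.length → ∀ t ∈ S,
    scale (a t) ≤ ((line (heights a) (c.getD j 0) (c.getD (j + 1) 0) t : ℝ) : EReal)

theorem IsChain.ne {a : ℕ → ℂ} {σ : ℝ} {S : Set ℕ} {c : List ℕ} (H : IsChain a σ S c) {i j : ℕ}
    (hij : i < j) (hj : j < c.length) : c.getD i 0 ≠ c.getD j 0 := by
  intro h
  have := H.sorted i j hij hj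
  rw [h] at this
  exact lt_irrefl _ this

theorem getD_reverse (c : List ℕ) {j : ℕ} (hj : j < c.length) :
    c.reverse.getD j 0 = c.getD (c.length - 1 - j) 0 := by
  rw [List.getD_eq_getElem _ _ (by simpa using hj), List.getElem_reverse,
    List.getD_eq_getElem]

/-- Reversal exchanges the two orientations, so that extensions on the right reduce to extensions on
the left. -/
theorem IsChain.reverse {a : ℕ → ℂ} {σ : ℝ} {S : Set ℕ} {c : List ℕ} (H : IsChain a σ S c) :
    IsChain a (-σ) S c.reverse := by
  rcases c.eq_nil_or_concat with rfl | hc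
  · exact ⟨H.nonempty, by simp, by simp, fun t ht => by simpa using neg_le_neg (H.last t ht),
      fun t ht => by simpa using neg_le_neg (H.head t ht), by simp⟩
  have hpos : 0 < c.length := by
    obtain ⟨l, b, rfl⟩ := hc; simp
  have hlen : c.reverse.length = c.length := List.length_reverse
  refine ⟨Or.inl (by omega), ?_, ?_, ?_, ?_, ?_⟩
  · intro i j hij hj
    rw [hlen] at hj
    rw [getD_reverse c (by omega), getD_reverse c hj]
    have := H.sorted (c.length - 1 - j) (c.length - 1 - i) (by omega) (by omega)
    linarith
  · intro j hj
    rw [hlen] at hj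
    rw [getD_reverse c hj]
    exact H.mem _ (by omega)
  · intro t ht
    rw [getD_reverse c hpos]
    have := H.last t ht
    simp only [Nat.sub_zero]
    linarith
  · intro t ht
    rw [hlen, getD_reverse c (by omega)]
    have := H.head t ht
    simp only [Nat.sub_self]
    linarith
  · intro j hj t ht
    rw [hlen] at hj
    rw [getD_reverse c (by omega), getD_reverse c hj, line_swap]
    · have := H.le_line (c.length - 1 - (j + 1)) (by omega) t ht
      rwa [show c.length - 1 - (j + 1) + 1 = c.length - 1 - j by omega] at this
    · exact (H.ne (show c.length - 1 - (j + 1) < c.length - 1 - j by omega) (by omega)).symm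

theorem getD_cons_drop (c : List ℕ) (k i j : ℕ) :
    (k :: c.drop i).getD (j + 1) 0 = c.getD (i + j) 0 := by
  simp [List.getD_eq_getElem?_getD, List.getElem?_drop]

/-- The inductive step of the construction of the concave cover. The line from the new point to the
first remaining vertex lies above the line of the last removed segment on its side of that vertex,
and above the line of the first remaining segment on the other side. -/
theorem IsChain.extend {a : ℕ → ℂ} {σ : ℝ} {S : Set ℕ} {c : List ℕ} (H : IsChain a σ S c)
    {k i : ℕ} (hk : a k ≠ 0) (hkc : 0 < c.length → σ * k < σ * c.getD 0 0)
    (hi : i ≤ c.length - 1)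
    (hbelow : i = 0 ∨ line (heights a) (c.getD (i - 1) 0) (c.getD i 0) k ≤ heights a k)
    (habove : i = c.length - 1 ∨
      heights a k ≤ line (heights a) (c.getD i 0) (c.getD (i + 1) 0) k) :
    IsChain a σ (insert k S) (k :: c.drop i) := by
  rcases Nat.eq_zero_or_pos c.length with hc | hpos
  · have hS : S = ∅ := H.nonempty.resolve_left (by omega)
    rw [List.eq_nil_of_length_eq_zero hc, hS]
    refine ⟨Or.inl (by simp), ?_, ?_, ?_, ?_, ?_⟩
    · intro i j hij hj; simp at hj; omega
    · intro j hj
      obtain rfl : j = 0 := by simpa using hj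
      simpa using hk
    all_goals simp
  have hkc := hkc hpos
  have hlen : (k :: c.drop i).length = c.length - i + 1 := by simp
  have hg0 : (k :: c.drop i).getD 0 0 = k := rfl
  have hkj : ∀ j < c.length, σ * k < σ * c.getD j 0 := by
    intro j hj
    rcases Nat.eq_zero_or_pos j with rfl | h0
    · exact hkc
    · exact hkc.trans (H.sorted 0 j h0 hj)
  have hne : ∀ j < c.length, (k : ℝ) ≠ c.getD j 0 := by
    intro j hj h
    have := hkj j hj
    rw [h] at this
    exact lt_irrefl _ this
  have hσ : 0 < σ * σ := by
    have : σ ≠ 0 := by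
      rintro rfl
      simp at hkc
    exact mul_self_pos.2 this
  have hmem : ∀ j < c.length, scale (a (c.getD j 0)) = (heights a (c.getD j 0) : EReal) :=
    fun j hj => scale_eq_heights (H.mem j hj).2
  -- the products of differences of abscissae have the sign given by the order of the chain
  have sgn : ∀ x y u : ℝ, 0 ≤ (σ * x - σ * u) * (σ * y - σ * u) → 0 ≤ (x - u) * (y - u) := by
    intro x y u h
    have : (σ * x - σ * u) * (σ * y - σ * u) = σ * σ * ((x - u) * (y - u)) := by ring
    rw [this] at h
    exact nonneg_of_mul_nonneg_right h hσ
  have sgn' : ∀ x y u : ℝ, (σ * x - σ * u) * (σ * y - σ * u) ≤ 0 → (x - u) * (y - u) ≤ 0 := by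
    intro x y u h
    have : (σ * x - σ * u) * (σ * y - σ * u) = σ * σ * ((x - u) * (y - u)) := by ring
    rw [this] at h
    exact nonpos_of_mul_nonpos_right h hσ
  have hcur : (k : ℕ) ≠ c.getD i 0 := fun h => hne i (by omega) (by exact_mod_cast h)
  -- the new segment is above all points of `S`
  have hnew : ∀ t ∈ S, scale (a t) ≤ ((line (heights a) k (c.getD i 0) t : ℝ) : EReal) := by
    intro t ht
    have eq_of : σ * t = σ * c.getD i 0 →
        scale (a t) ≤ ((line (heights a) k (c.getD i 0) t : ℝ) : EReal) := by
      intro h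
      have h' : (t : ℝ) = c.getD i 0 := mul_left_cancel₀ (by rintro rfl; simp at hσ) h
      have h'' : t = c.getD i 0 := by exact_mod_cast h'
      rw [h'', hmem i (by omega), line_right _ hcur]
    rcases le_total (σ * t) (σ * c.getD i 0) with hti | hti
    · by_cases h0 : i = 0
      · exact eq_of (le_antisymm hti (by rw [h0]; exact H.head t ht))
      have hl := H.le_line (i - 1) (by omega) t ht
      rw [Nat.sub_add_cancel (by omega)] at hl
      refine hl.trans (EReal.coe_le_coe_iff.2 ?_)
      refine line_le_of_same (heights a) (hne i (by omega)).symm (sgn _ _ _ ?_) ?_ ?_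
      · have := hkj i (by omega)
        exact mul_nonneg_of_nonpos_of_nonpos (by linarith) (by linarith)
      · rw [line_right _ (H.ne (show i - 1 < i by omega) (by omega)), line_right _ hcur]
      · rw [line_left]; exact hbelow.resolve_left h0
    · by_cases h0 : i = c.length - 1
      · exact eq_of (le_antisymm (by rw [h0]; exact H.last t ht) hti)
      refine (H.le_line i (by omega) t ht).trans (EReal.coe_le_coe_iff.2 ?_)
      refine line_le_of_opposite (heights a) (hne i (by omega)).symm (sgn' _ _ _ ?_) ?_ ?_
      · have := hkj i (by omega)
        exact mul_nonpos_of_nonneg_of_nonpos (by linarith) (by linarith)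
      · rw [line_left, line_right _ hcur]
      · rw [line_left]; exact habove.resolve_left h0
  -- the remaining segments are above the new point
  have hold : ∀ j, i ≤ j → j + 1 < c.length →
      heights a k ≤ line (heights a) (c.getD j 0) (c.getD (j + 1) 0) k := by
    intro j hij hj
    have ha := habove.resolve_left (by omega)
    rcases hij.eq_or_lt with rfl | hij
    · exact ha
    refine ha.trans ?_
    have e1 := H.le_line j hj _ (H.mem i (by omega)).1
    have e2 := H.le_line i (by omega) _ (H.mem (j + 1) hj).1
    rw [hmem _ (by omega), EReal.coe_le_coe_iff] at e1 e2
    have hlt := H.sorted i (j + 1) (by omega) hj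
    refine line_le_of_opposite (heights a) (u := c.getD i 0) (v := c.getD (j + 1) 0) ?_
      (sgn' _ _ _ ?_) ?_ ?_
    · exact_mod_cast H.ne (show i < j + 1 by omega) hj
    · have := hkj i (by omega)
      exact mul_nonpos_of_nonpos_of_nonneg (by linarith) (by linarith)
    · rwa [line_left]
    · rwa [line_right _ (H.ne (show j < j + 1 by omega) hj)]
  refine ⟨Or.inl (by omega), ?_, ?_, ?_, ?_, ?_⟩
  · intro p q hpq hq
    rw [hlen] at hq
    obtain ⟨q, rfl⟩ : ∃ q', q = q' + 1 := ⟨q - 1, by omega⟩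
    rw [getD_cons_drop]
    rcases p with _ | p
    · rw [hg0]; exact hkj _ (by omega)
    · rw [getD_cons_drop]; exact H.sorted _ _ (by omega) (by omega)
  · intro j hj
    rw [hlen] at hj
    rcases j with _ | j
    · exact ⟨Set.mem_insert _ _, hk⟩
    · rw [getD_cons_drop]
      exact ⟨Set.mem_insert_of_mem _ (H.mem _ (by omega)).1, (H.mem _ (by omega)).2⟩
  · rintro t (rfl | ht)
    · exact le_rfl
    · exact hkc.le.trans (H.head t ht)
  · have e : (k :: c.drop i).getD ((k :: c.drop i).length - 1) 0 = c.getD (c.length - 1) 0 := by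
      rw [hlen, show c.length - i + 1 - 1 = (c.length - 1 - i) + 1 by omega, getD_cons_drop]
      congr 1; omega
    rw [e]
    rintro t (rfl | ht)
    · exact (hkj _ (by omega)).le
    · exact H.last t ht
  · intro j hj t ht
    rw [hlen] at hj
    rcases j with _ | j
    · rw [hg0, getD_cons_drop, add_zero]
      rcases ht with rfl | ht
      · rw [line_left, scale_eq_heights hk]
      · exact hnew t ht
    · rw [getD_cons_drop, getD_cons_drop]
      rcases ht with rfl | ht
      · rw [scale_eq_heights hk, EReal.coe_le_coe_iff]
        exact hold _ (by omega) (by omega)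
      · exact H.le_line _ (by omega) t ht

/-- A point between the ends of the chain whose scale does not exceed the previous ones is below
the concave cover. -/
theorem IsChain.insert_between {a : ℕ → ℂ} {S : Set ℕ} {c : List ℕ} (H : IsChain a 1 S c)
    (hpos : 0 < c.length) {k : ℕ} (h1 : c.getD 0 0 ≤ k) (h2 : k ≤ c.getD (c.length - 1) 0)
    (hk : ∀ t ∈ S, scale (a k) ≤ scale (a t)) : IsChain a 1 (insert k S) c := by
  refine ⟨Or.inl hpos, H.sorted, fun j hj => ⟨Set.mem_insert_of_mem _ (H.mem j hj).1,
    (H.mem j hj).2⟩, ?_, ?_, ?_⟩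
  · rintro t (rfl | ht)
    · simpa using h1
    · exact H.head t ht
  · rintro t (rfl | ht)
    · simpa using h2
    · exact H.last t ht
  · rintro j hj t (rfl | ht)
    · by_cases h0 : a t = 0
      · simp [scale, h0]
      rw [scale_eq_heights h0] at hk ⊢
      rw [EReal.coe_le_coe_iff]
      have m0 := (H.mem 0 hpos).1
      have m1 := (H.mem (c.length - 1) (by omega)).1
      refine le_line_of_between (heights a) (u := c.getD 0 0) (v := c.getD (c.length - 1) 0)
        (by exact_mod_cast h1) (by exact_mod_cast h2) ?_ ?_
      · exact EReal.coe_le_coe_iff.1 ((hk _ m0).trans (H.le_line j hj _ m0))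
      · exact EReal.coe_le_coe_iff.1 ((hk _ m1).trans (H.le_line j hj _ m1))
    · exact H.le_line j hj t ht

/-! ### Construction of the chain -/

theorem onTest_notBelow (a : ℕ → ℂ) (τ : ℝ) (i j : ℕ) {k : ℕ} (hk : a k ≠ 0) :
    (preMachine a τ).onTest (.notBelow i j k) (heights a) =
      (decide (line (heights a) i j k ≤ heights a k), heights a) := by
  simp only [preMachine, scale_eq_heights hk, EReal.coe_le_coe_iff, lineHeight_eq]

theorem run_extend {a : ℕ → ℂ} {τ σ : ℝ} {S : Set ℕ} {c : List ℕ} (H : IsChain a σ S c)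
    {k : ℕ} (hk : a k ≠ 0) (hkc : 0 < c.length → σ * k < σ * c.getD 0 0) :
    ((preMachine a τ).run (extend c k) (heights a)).state = heights a ∧
    ((preMachine a τ).run (extend c k) (heights a)).acts = [] ∧
    ((preMachine a τ).run (extend c k) (heights a)).tests ≤ (c.length - 1).size ∧
    ((preMachine a τ).run (extend c k) (heights a)).value.length ≤ c.length + 1 ∧
    IsChain a σ (insert k S) ((preMachine a τ).run (extend c k) (heights a)).value := by
  have hb := run_bisect (preMachine a τ) (heights a)
    (fun j => PreTest.notBelow (c.getD j 0) (c.getD (j + 1) 0) k) (fun j => rfl) (c.length - 1) 0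
  obtain ⟨h1, h2, h3, -, h5, h6, h7⟩ := hb
  simp only [extend, run_bind, run_pure]
  refine ⟨h1, by rw [h2]; rfl, by simpa using h3, by simp, ?_⟩
  simp only [onTest_notBelow a τ _ _ hk, decide_eq_true_eq, decide_eq_false_iff_not, not_le,
    zero_add] at h5 h6 h7
  set i := ((preMachine a τ).run (bisect (fun j => PreTest.notBelow (c.getD j 0)
    (c.getD (j + 1) 0) k) (c.length - 1) 0) (heights a)).value
  refine H.extend hk hkc h5 ?_ (h7.imp id le_of_lt)
  by_cases h0 : i = 0
  · exact Or.inl h0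
  · have := h6.resolve_left h0
    rw [Nat.sub_add_cancel (Nat.pos_of_ne_zero h0)] at this
    exact Or.inr this

/-- Adding an index to the chain, when the previous indices have larger scales: only an index
beyond one of the ends can be a vertex. -/
theorem run_insertVertex {a : ℕ → ℂ} {τ : ℝ} {S : Set ℕ} {c : List ℕ} (H : IsChain a 1 S c)
    {k : ℕ} (hmin : ∀ t ∈ S, scale (a k) ≤ scale (a t))
    (hk : a k = 0 → (∃ t ∈ S, t ≤ k) ∧ ∃ t ∈ S, k ≤ t) :
    ((preMachine a τ).run (insertVertex c k) (heights a)).state = heights a ∧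
    ((preMachine a τ).run (insertVertex c k) (heights a)).acts = [] ∧
    ((preMachine a τ).run (insertVertex c k) (heights a)).tests ≤ (c.length - 1).size ∧
    ((preMachine a τ).run (insertVertex c k) (heights a)).value.length ≤ c.length + 1 ∧
    IsChain a 1 (insert k S) ((preMachine a τ).run (insertVertex c k) (heights a)).value := by
  have hhead : 0 < c.length → c.headD (k + 1) = c.getD 0 0 := by
    intro h
    cases c with
    | nil => simp at h
    | cons x c => rfl
  have hlast : 0 < c.length → c.getLastD 0 = c.getD (c.length - 1) 0 := by
    intro h
    rw [List.getLastD_eq_getLast?, List.getLast?_eq_getElem?, List.getD_eq_getElem?_getD]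
  rw [insertVertex]
  split_ifs with h1 h2
  · have h1' : 0 < c.length → k < c.getD 0 0 := fun h => by rwa [hhead h] at h1
    refine run_extend H (fun h => ?_) fun h => by simpa using h1' h
    obtain ⟨⟨t, ht, htk⟩, -⟩ := hk h
    have hpos := H.nonempty.resolve_right (Set.nonempty_iff_ne_empty.1 ⟨t, ht⟩)
    have := H.head t ht
    simp only [one_mul, Nat.cast_le] at this
    have := h1' hpos
    omega
  · have hpos : 0 < c.length := by
      by_contra hc
      obtain rfl := List.eq_nil_of_length_eq_zero (by omega : c.length = 0)
      simp at h1
    rw [hlast hpos] at h2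
    have hk0 : a k ≠ 0 := by
      intro h
      obtain ⟨-, t, ht, htk⟩ := hk h
      have := H.last t ht
      simp only [one_mul, Nat.cast_le] at this
      omega
    have hc0 : c.reverse.getD 0 0 = c.getD (c.length - 1) 0 := by
      rw [getD_reverse c hpos]; simp
    obtain ⟨e1, e2, e3, e4, e5⟩ := run_extend (τ := τ) H.reverse hk0 (fun _ => by
      rw [hc0]; simpa using h2)
    simp only [run_bind, run_pure]
    rw [List.length_reverse] at e3 e4
    refine ⟨e1, by simp [e2], by simpa using e3, by simpa using e4, ?_⟩
    simpa using e5.reverse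
  · have hpos : 0 < c.length := by
      by_contra hc
      obtain rfl := List.eq_nil_of_length_eq_zero (by omega : c.length = 0)
      simp at h1
    rw [hhead hpos] at h1
    rw [hlast hpos] at h2
    exact ⟨rfl, rfl, Nat.zero_le _, Nat.le_succ _,
      H.insert_between hpos (by omega) (by omega) hmin⟩

/-- Construction of the chain, by indices of decreasing scale. The zero coefficients come last, when
both `0` and `d` have been treated, so that they fall between the ends. -/
theorem run_buildHull {a : ℕ → ℂ} {τ : ℝ} {d : ℕ} (h0 : a 0 ≠ 0) (hd : a d ≠ 0) (ks c : List ℕ)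
    (S : Set ℕ) (H : IsChain a 1 S c)
    (hle : ∀ k ∈ ks, k ≤ d) (h0S : 0 ∈ S ∨ 0 ∈ ks) (hdS : d ∈ S ∨ d ∈ ks)
    (hS : ∀ t ∈ S, ∀ k ∈ ks, scale (a k) ≤ scale (a t))
    (hord : ks.Pairwise fun i j => scale (a j) ≤ scale (a i)) :
    ((preMachine a τ).run (buildHull c ks) (heights a)).state = heights a ∧
    (∀ n ∈ ((preMachine a τ).run (buildHull c ks) (heights a)).acts,
      n ≤ ks.length + c.length + 1) ∧
    ((preMachine a τ).run (buildHull c ks) (heights a)).tests ≤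
      ∑ j ∈ Finset.range ks.length, (c.length + j - 1).size ∧
    ((preMachine a τ).run (buildHull c ks) (heights a)).value.length ≤ c.length + ks.length ∧
    IsChain a 1 (S ∪ {k | k ∈ ks})
      ((preMachine a τ).run (buildHull c ks) (heights a)).value := by
  induction ks generalizing c S with
  | nil => simpa [buildHull] using H
  | cons k ks ih =>
    have hk : a k = 0 → (∃ t ∈ S, t ≤ k) ∧ ∃ t ∈ S, k ≤ t := by
      intro hk0
      have key : ∀ t, a t ≠ 0 → t ∈ S ∨ t ∈ k :: ks → t ∈ S := by
        rintro t ht (h | h)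
        · exact h
        · rcases List.mem_cons.1 h with rfl | h
          · exact absurd hk0 ht
          · have := (List.pairwise_cons.1 hord).1 t h
            rw [scale_eq_heights ht, scale, if_pos hk0] at this
            simp at this
      exact ⟨⟨0, key 0 h0 h0S, Nat.zero_le _⟩, d, key d hd hdS, hle k (by simp)⟩
    obtain ⟨s1, m1, t1, l1, H1⟩ := run_insertVertex (τ := τ) H
      (fun t ht => hS t ht k (by simp)) hk
    rw [List.pairwise_cons] at hord
    have := ih _ (insert k S) H1
      (fun j hj => hle j (List.mem_cons_of_mem _ hj))
      (by
        rcases h0S with h | h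
        · exact Or.inl (Set.mem_insert_of_mem _ h)
        · rcases List.mem_cons.1 h with rfl | h
          · exact Or.inl (Set.mem_insert _ _)
          · exact Or.inr h)
      (by
        rcases hdS with h | h
        · exact Or.inl (Set.mem_insert_of_mem _ h)
        · rcases List.mem_cons.1 h with rfl | h
          · exact Or.inl (Set.mem_insert _ _)
          · exact Or.inr h)
      (by
        rintro t (rfl | ht) j hj
        · exact hord.1 j hj
        · exact hS t ht j (List.mem_cons_of_mem _ hj))
      hord.2
    obtain ⟨s2, m2, t2, l2, H2⟩ := this
    have act : ∀ n h, (preMachine a τ).onAct n h = h := fun n h => rfl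
    simp only [buildHull, run_bind, run_perform, act, s1, m1, List.nil_append, List.mem_append,
      List.mem_singleton, List.length_cons, zero_add]
    refine ⟨s2, ?_, ?_, by omega, ?_⟩
    · rintro n (rfl | hn)
      · exact le_rfl
      · have := m2 n hn; omega
    · rw [Finset.sum_range_succ', add_comm]
      refine add_le_add (t2.trans (Finset.sum_le_sum fun j _ => Nat.size_le_size (by omega))) ?_
      simpa using t1
    · convert H2 using 1
      ext t
      simp only [Set.mem_union, Set.mem_ofPred_eq, List.mem_cons, Set.mem_insert_iff]
      tauto

/-! ### The concave cover as a piecewise linear function -/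

theorem concaveOn_line (h : ℕ → ℝ) (i j : ℕ) (s : Set ℝ) (hs : Convex ℝ s) :
    ConcaveOn ℝ s (line h i j) := by
  refine ⟨hs, fun x _ y _ α β _ _ hαβ => le_of_eq ?_⟩
  obtain rfl : α = 1 - β := by linarith
  simp only [line, smul_eq_mul]
  ring

section Cover

variable {P : ℂ[X]} {c : List ℕ}

theorem IsChain.head_eq (H : IsChain P.coeff 1 {k | k ≤ P.natDegree} c) : c.getD 0 0 = 0 := by
  have := H.head 0 (Nat.zero_le _)
  simpa using this

theorem IsChain.length_pos (H : IsChain P.coeff 1 {k | k ≤ P.natDegree} c) : 0 < c.length :=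
  H.nonempty.resolve_right (Set.nonempty_iff_ne_empty.1 ⟨0, Nat.zero_le _⟩)

theorem IsChain.last_eq (H : IsChain P.coeff 1 {k | k ≤ P.natDegree} c) :
    c.getD (c.length - 1) 0 = P.natDegree := by
  have h1 := H.last P.natDegree (le_refl P.natDegree)
  have h2 := (H.mem (c.length - 1) (by have := H.length_pos; omega)).1
  simp only [one_mul, Nat.cast_le, Set.mem_ofPred_eq] at h1 h2
  omega

theorem IsChain.two_le_length (H : IsChain P.coeff 1 {k | k ≤ P.natDegree} c)
    (hd : 1 ≤ P.natDegree) : 2 ≤ c.length := by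
  by_contra hc
  have h1 := H.last_eq
  have h2 := H.head_eq
  have : c.length - 1 = 0 := by omega
  rw [this] at h1
  omega

theorem IsChain.exists_segment (H : IsChain P.coeff 1 {k | k ≤ P.natDegree} c)
    (hd : 1 ≤ P.natDegree) {x : ℝ} (hx : x ∈ Set.Icc (0 : ℝ) P.natDegree) :
    ∃ j, j + 1 < c.length ∧ x ∈ Set.Icc (c.getD j 0 : ℝ) (c.getD (j + 1) 0) := by
  by_contra! hcon
  have h2 := H.two_le_length hd
  have key : ∀ j, j + 1 < c.length → (c.getD (j + 1) 0 : ℝ) < x := by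
    intro j
    induction j with
    | zero =>
      intro hj
      by_contra hle
      exact hcon 0 hj ⟨by rw [H.head_eq]; simpa using hx.1, not_lt.1 hle⟩
    | succ j ih =>
      intro hj
      by_contra hle
      exact hcon (j + 1) hj ⟨(ih (by omega)).le, not_lt.1 hle⟩
  have := key (c.length - 2) (by omega)
  rw [show c.length - 2 + 1 = c.length - 1 by omega, H.last_eq] at this
  exact absurd hx.2 (not_le.2 this)

/-- A concave majorant of the scales is above each segment of the chain. -/
theorem IsChain.line_le (H : IsChain P.coeff 1 {k | k ≤ P.natDegree} c) {f : ℝ → ℝ}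
    (hf : ConcaveOn ℝ (Set.Icc 0 (P.natDegree : ℝ)) f)
    (hs : ∀ k ≤ P.natDegree, scale (P.coeff k) ≤ ((f k : ℝ) : EReal)) {j : ℕ}
    (hj : j + 1 < c.length) {x : ℝ} (hx : x ∈ Set.Icc (c.getD j 0 : ℝ) (c.getD (j + 1) 0)) :
    line (heights P.coeff) (c.getD j 0) (c.getD (j + 1) 0) x ≤ f x := by
  have m1 := H.mem j (by omega)
  have m2 := H.mem (j + 1) hj
  have s1 := hs _ m1.1
  have s2 := hs _ m2.1
  rw [scale_eq_heights m1.2, EReal.coe_le_coe_iff] at s1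
  rw [scale_eq_heights m2.2, EReal.coe_le_coe_iff] at s2
  have hlt : (c.getD j 0 : ℝ) < c.getD (j + 1) 0 := by
    simpa using H.sorted j (j + 1) (by omega) hj
  have hw : (0 : ℝ) < c.getD (j + 1) 0 - c.getD j 0 := by linarith
  have hu : (c.getD j 0 : ℝ) ∈ Set.Icc (0 : ℝ) P.natDegree :=
    ⟨Nat.cast_nonneg _, by exact_mod_cast m1.1⟩
  have hv : (c.getD (j + 1) 0 : ℝ) ∈ Set.Icc (0 : ℝ) P.natDegree :=
    ⟨Nat.cast_nonneg _, by exact_mod_cast m2.1⟩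
  generalize c.getD j 0 = u at *
  generalize c.getD (j + 1) 0 = v at *
  have hα : 0 ≤ ((v : ℝ) - x) / ((v : ℝ) - u) := div_nonneg (by linarith [hx.2]) hw.le
  have hβ : 0 ≤ (x - u) / ((v : ℝ) - u) := div_nonneg (by linarith [hx.1]) hw.le
  have := hf.2 hu hv hα hβ (by field_simp; ring)
  have e : (((v : ℝ) - x) / ((v : ℝ) - u)) • (u : ℝ) + ((x - u) / ((v : ℝ) - u)) • (v : ℝ) = x := by
    simp only [smul_eq_mul]; field_simp; ring
  rw [e] at this
  refine le_trans ?_ this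
  have e2 : line (heights P.coeff) u v x =
      (v - x) / (v - u) * heights P.coeff u + (x - u) / (v - u) * heights P.coeff v := by
    simp only [line]; field_simp; ring
  rw [e2]
  simp only [smul_eq_mul]
  exact add_le_add (mul_le_mul_of_nonneg_left s1 hα)
    (mul_le_mul_of_nonneg_left s2 hβ)

/-- The line of a segment is one of the concave majorants. -/
theorem IsChain.cover_le (H : IsChain P.coeff 1 {k | k ≤ P.natDegree} c)
    (hd : 1 ≤ P.natDegree) {j : ℕ} (hj : j + 1 < c.length) {x : ℝ}
    (hx : x ∈ Set.Icc (0 : ℝ) P.natDegree) :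
    concaveCover P x ≤ line (heights P.coeff) (c.getD j 0) (c.getD (j + 1) 0) x := by
  refine csInf_le ?_ ⟨_, concaveOn_line _ _ _ _ (convex_Icc _ _), fun k hk => H.le_line j hj k hk,
    rfl⟩
  obtain ⟨i, hi, hxi⟩ := H.exists_segment hd hx
  refine ⟨line (heights P.coeff) (c.getD i 0) (c.getD (i + 1) 0) x, ?_⟩
  rintro y ⟨f, hf, hs, rfl⟩
  exact H.line_le hf hs hi hxi

theorem IsChain.segment_subset (H : IsChain P.coeff 1 {k | k ≤ P.natDegree} c) {j : ℕ}
    (hj : j + 1 < c.length) {x : ℝ} (hx : x ∈ Set.Icc (c.getD j 0 : ℝ) (c.getD (j + 1) 0)) :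
    x ∈ Set.Icc (0 : ℝ) P.natDegree := by
  have m2 := (H.mem (j + 1) hj).1
  exact ⟨(Nat.cast_nonneg _).trans hx.1, hx.2.trans (by exact_mod_cast m2)⟩

theorem IsChain.cover_eq (H : IsChain P.coeff 1 {k | k ≤ P.natDegree} c)
    (hd : 1 ≤ P.natDegree) {j : ℕ} (hj : j + 1 < c.length) {x : ℝ}
    (hx : x ∈ Set.Icc (c.getD j 0 : ℝ) (c.getD (j + 1) 0)) :
    concaveCover P x = line (heights P.coeff) (c.getD j 0) (c.getD (j + 1) 0) x := by
  refine le_antisymm (H.cover_le hd hj (H.segment_subset hj hx)) ?_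
  refine le_csInf ⟨_, _, concaveOn_line _ _ _ _ (convex_Icc _ _),
    fun k hk => H.le_line j hj k hk, rfl⟩ ?_
  rintro y ⟨f, hf, hs, rfl⟩
  exact H.line_le hf hs hj hx

theorem IsChain.cover_vertex (H : IsChain P.coeff 1 {k | k ≤ P.natDegree} c)
    (hd : 1 ≤ P.natDegree) {j : ℕ} (hj : j < c.length) :
    concaveCover P (c.getD j 0) = heights P.coeff (c.getD j 0) := by
  have h2 := H.two_le_length hd
  have lt : ∀ i, i + 1 < c.length → (c.getD i 0 : ℝ) ≤ c.getD (i + 1) 0 := by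
    intro i hi
    simpa using (H.sorted i (i + 1) (by omega) hi).le
  by_cases h : j + 1 < c.length
  · rw [H.cover_eq hd h ⟨le_rfl, lt j h⟩, line_left]
  · obtain ⟨i, rfl⟩ : ∃ i, j = i + 1 := ⟨j - 1, by omega⟩
    rw [H.cover_eq hd hj ⟨lt i hj, le_rfl⟩, line_right _ (H.ne (Nat.lt_succ_self i) hj)]

theorem IsChain.concaveOn_cover (H : IsChain P.coeff 1 {k | k ≤ P.natDegree} c)
    (hd : 1 ≤ P.natDegree) :
    ConcaveOn ℝ (Set.Icc (0 : ℝ) P.natDegree) (concaveCover P) := by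
  refine ⟨convex_Icc _ _, fun x hx y hy α β hα hβ hαβ => ?_⟩
  obtain ⟨j, hj, hz⟩ := H.exists_segment hd (convex_Icc _ _ hx hy hα hβ hαβ)
  rw [H.cover_eq hd hj hz]
  refine le_trans ?_ ((concaveOn_line _ _ _ _ (convex_Icc _ _)).2 hx hy hα hβ hαβ)
  exact add_le_add (smul_le_smul_of_nonneg_left (H.cover_le hd hj hx) hα)
    (smul_le_smul_of_nonneg_left (H.cover_le hd hj hy) hβ)

end Cover

/-! ### The list of good indices -/

/-- The heights at `i` and `j` do not change during the scan, hence the line does not either. -/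
theorem run_scanGap (a : ℕ → ℂ) (τ : ℝ) (i j : ℕ) (ks : List ℕ) (hi : i ∉ ks) (hj : j ∉ ks)
    (h : ℕ → ℝ) :
    (∀ k, ((preMachine a τ).run (scanGap i j ks) h).state k =
      if k ∈ ks then line h i j k else h k) ∧
    (∀ k, k ∈ ((preMachine a τ).run (scanGap i j ks) h).value ↔
      k ∈ ks ∧ ((line h i j k - τ : ℝ) : EReal) ≤ scale (a k)) ∧
    ((preMachine a τ).run (scanGap i j ks) h).tests = ks.length ∧
    ((preMachine a τ).run (scanGap i j ks) h).acts = [] ∧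
    ((preMachine a τ).run (scanGap i j ks) h).value.length ≤ ks.length := by
  induction ks generalizing h with
  | nil => simp [scanGap]
  | cons k ks ih =>
    simp only [List.mem_cons, not_or] at hi hj
    have hline : ∀ x, line (Function.update h k (lineHeight h i j k)) i j x = line h i j x :=
      line_congr (Function.update_of_ne hi.1 _ _) (Function.update_of_ne hj.1 _ _)
    obtain ⟨e1, e2, e3, e4, e5⟩ := ih hi.2 hj.2 (Function.update h k (lineHeight h i j k))
    have ht : (preMachine a τ).onTest (.good i j k) h =
      (decide (((line h i j k - τ : ℝ) : EReal) ≤ scale (a k)),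
        Function.update h k (lineHeight h i j k)) := rfl
    simp only [scanGap, run_bind, run_ask, run_pure, ht, hline] at e1 e2 ⊢
    refine ⟨fun t => ?_, fun t => ?_, ?_, by simp [e4], ?_⟩
    · rw [e1]
      by_cases htk : t = k
      · subst htk
        simp [lineHeight_eq]
      · simp [htk]
    · by_cases hg : ((line h i j k - τ : ℝ) : EReal) ≤ scale (a k)
      · simp only [hg, decide_true, if_true, List.mem_cons, e2]
        constructor
        · rintro (rfl | h)
          · exact ⟨Or.inl rfl, hg⟩
          · exact ⟨Or.inr h.1, h.2⟩
        · rintro ⟨rfl | h, h'⟩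
          · exact Or.inl rfl
          · exact Or.inr ⟨h, h'⟩
      · simp only [hg, decide_false, Bool.false_eq_true, if_false, List.mem_cons, e2]
        constructor
        · exact fun h => ⟨Or.inr h.1, h.2⟩
        · rintro ⟨rfl | h, h'⟩
          · exact absurd h' hg
          · exact ⟨h, h'⟩
    · rw [e3, List.length_cons]; omega
    · split_ifs
      · simpa using e5
      · rw [List.length_cons]; omega

theorem mem_gap {i j k : ℕ} : k ∈ (List.range j).filter (fun k => i < k) ↔ i < k ∧ k < j := by
  simp [and_comm]

theorem length_gap (i j : ℕ) : ((List.range j).filter fun k => i < k).length = j - i - 1 := by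
  rw [← List.toFinset_card_of_nodup (List.nodup_range.filter _), ← Nat.card_Ioo]
  congr 1
  ext k
  simp only [List.mem_toFinset, mem_gap, Finset.mem_Ioo]

/-- Scanning the gaps between the vertices `c` of a piecewise linear function `E`. -/
theorem run_scan (a : ℕ → ℂ) (τ : ℝ) (E : ℕ → ℝ) (c : List ℕ) (hpos : 0 < c.length)
    (hc : ∀ p, p + 1 < c.length → c.getD p 0 < c.getD (p + 1) 0)
    (hE : ∀ p, p + 1 < c.length → ∀ k, c.getD p 0 ≤ k → k ≤ c.getD (p + 1) 0 →
      line E (c.getD p 0) (c.getD (p + 1) 0) k = E k)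
    (hg : ∀ p < c.length, ((E (c.getD p 0) - τ : ℝ) : EReal) ≤ scale (a (c.getD p 0)))
    (h : ℕ → ℝ) (hh : ∀ p < c.length, h (c.getD p 0) = E (c.getD p 0)) :
    c.getD 0 0 ≤ c.getD (c.length - 1) 0 ∧
    (∀ k, ((preMachine a τ).run (scan c) h).state k =
      if c.getD 0 0 ≤ k ∧ k ≤ c.getD (c.length - 1) 0 then E k else h k) ∧
    (∀ k, k ∈ ((preMachine a τ).run (scan c) h).value ↔
      (c.getD 0 0 ≤ k ∧ k ≤ c.getD (c.length - 1) 0) ∧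
        ((E k - τ : ℝ) : EReal) ≤ scale (a k)) ∧
    ((preMachine a τ).run (scan c) h).tests + c.length + c.getD 0 0 ≤
      c.getD (c.length - 1) 0 + 1 ∧
    ((preMachine a τ).run (scan c) h).acts = [] ∧
    ((preMachine a τ).run (scan c) h).value.length + c.getD 0 0 ≤
      c.getD (c.length - 1) 0 + 1 := by
  induction c generalizing h with
  | nil => simp at hpos
  | cons i c ih =>
    rcases c with _ | ⟨j, c⟩
    · have h0 := hh 0 (by simp)
      have g0 := hg 0 (by simp)
      simp only [List.getD_cons_zero] at h0 g0
      simp only [scan, run_ret, List.length_singleton, Nat.sub_self, List.getD_cons_zero,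
        List.mem_singleton]
      refine ⟨le_rfl, fun k => ?_, fun k => ?_, by omega, trivial, by omega⟩
      · split_ifs with hk
        · obtain rfl : k = i := by omega
          exact h0
        · rfl
      · constructor
        · rintro rfl
          exact ⟨⟨le_rfl, le_rfl⟩, g0⟩
        · rintro ⟨hk, -⟩
          omega
    · have hij : i < j := by simpa using hc 0 (by simp)
      have hlast : (i :: j :: c).getD ((i :: j :: c).length - 1) 0 =
          (j :: c).getD ((j :: c).length - 1) 0 := by simp
      have hjh : (j :: c).getD 0 0 = j := rfl
      have hih : (i :: j :: c).getD 0 0 = i := rfl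
      have hlen : (i :: j :: c).length = (j :: c).length + 1 := rfl
      have hi0 := hh 0 (by simp)
      have hj0 := hh 1 (by simp)
      have gi := hg 0 (by simp)
      have hl := hE 0 (by simp)
      simp only [List.getD_cons_zero, List.getD_cons_succ, zero_add] at hi0 hj0 gi hl
      obtain ⟨g1, g2, g3, g4, g5⟩ := run_scanGap a τ i j
        ((List.range j).filter fun k => i < k) (by simp) (by simp) h
      rw [length_gap] at g3 g5
      simp only [mem_gap] at g1 g2
      have hline : ∀ x, line h i j x = line E i j x := line_congr hi0 hj0
      set h' := ((preMachine a τ).run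
        (scanGap i j ((List.range j).filter fun k => i < k)) h).state with hh'
      have hge : ∀ p < (j :: c).length, j ≤ (j :: c).getD p 0 := by
        intro p
        induction p with
        | zero => intro _; simp
        | succ p ihp =>
          intro hp
          exact (ihp (by omega)).trans (by simpa using (hc (p + 1) (by simpa using hp)).le)
      obtain ⟨f0, f1, f2, f3, f4, f5⟩ := ih (by simp)
        (fun p hp => by simpa using hc (p + 1) (by simpa using hp))
        (fun p hp => by simpa using hE (p + 1) (by simpa using hp))
        (fun p hp => by simpa using hg (p + 1) (by simpa using hp)) h'
        (fun p hp => by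
          have h1 := hge p hp
          rw [g1, if_neg (by omega)]
          simpa using hh (p + 1) (by simpa using hp))
      rw [hlast, hih]
      rw [hjh] at f0 f1 f2 f3 f5
      simp only [scan, run_bind, run_pure, ← hh']
      generalize (j :: c).getD ((j :: c).length - 1) 0 = r at *
      refine ⟨by omega, fun k => ?_, fun k => ?_, ?_, by simp [g4, f4], ?_⟩
      · rw [f1, g1, hline]
        by_cases h1 : j ≤ k ∧ k ≤ r
        · rw [if_pos h1, if_pos (by omega)]
        · rw [if_neg h1]
          by_cases h2 : i < k ∧ k < j
          · rw [if_pos h2, if_pos (by omega), hl k h2.1.le h2.2.le]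
          · rw [if_neg h2]
            split_ifs with h3
            · obtain rfl : k = i := by omega
              exact hi0
            · rfl
      · simp only [List.mem_cons, List.mem_append, g2, f2, hline]
        constructor
        · rintro (rfl | ⟨hk, hk'⟩ | ⟨hk, hk'⟩)
          · exact ⟨by omega, gi⟩
          · rw [hl k hk.1.le hk.2.le] at hk'
            exact ⟨by omega, hk'⟩
          · exact ⟨by omega, hk'⟩
        · rintro ⟨hk, hk'⟩
          by_cases h1 : k = i
          · exact Or.inl h1
          · by_cases h2 : k < j
            · refine Or.inr (Or.inl ⟨by omega, ?_⟩)
              rwa [hl k (by omega) h2.le]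
            · exact Or.inr (Or.inr ⟨by omega, hk'⟩)
      · rw [g3, hlen]; omega
      · simp only [List.length_cons, List.length_append]; omega

/-! ### The preconditioning phase -/

theorem thickness_eq {d : ℕ} (hd : 1 ≤ d) (p : ℕ) :
    thickness d p = p + Nat.log 2 d + 4 := by
  have : ⌊Real.logb 2 (d : ℝ)⌋ = (Nat.log 2 d : ℤ) := by
    have := Real.floor_logb_natCast (b := 2) (r := (d : ℝ)) (by positivity)
    rw [Nat.cast_ofNat] at this
    rw [this, Int.log_natCast]
  simp only [thickness, scaleInt, Complex.norm_natCast, this]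
  push_cast
  ring

theorem thickness_nonneg {d : ℕ} (hd : 1 ≤ d) (p : ℕ) : 0 ≤ thickness d p := by
  rw [thickness_eq hd]; positivity

/-- What the preconditioning phase achieves. -/
structure PreSpec (P : ℂ[X]) (p : ℕ) : Prop where
  degree : (preRun P p).value.degree = P.natDegree
  chain : IsChain P.coeff 1 {k | k ≤ P.natDegree} (preRun P p).value.verts
  state : ∀ k ≤ P.natDegree, (preRun P p).state k = concaveCover P k
  good : ∀ k, k ∈ (preRun P p).value.good ↔ k ∈ goodIndices P p
  memory : ∀ n ∈ (preRun P p).acts, n ≤ 2 * (P.natDegree + 1)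
  tests : ∀ c, P.natDegree < 2 ^ c → 2 ^ c ≤ 2 * (P.natDegree + 1) →
    preTime P p + 2 ^ c ≤ (P.natDegree + 1) * c + 1 +
      ∑ m ∈ Finset.range P.natDegree, m.size + (P.natDegree - 1)

theorem preSpec {P : ℂ[X]} (p : ℕ) (hd : 1 ≤ P.natDegree) (h0 : P.coeff 0 ≠ 0) :
    PreSpec P p := by
  have hP : P.coeff P.natDegree ≠ 0 := by
    rw [coeff_natDegree, leadingCoeff_ne_zero]
    rintro rfl
    simp at h0
  set d := P.natDegree with hdd
  set τ := thickness d p with hτ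
  have hτ0 : 0 ≤ τ := thickness_nonneg hd p
  have hinit : (fun k => (scaleInt (P.coeff k) : ℝ)) = heights P.coeff := rfl
  obtain ⟨s1, m1, t1, p1, o1⟩ :=
    run_mergeSort P.coeff τ (heights P.coeff) 0 (List.range (d + 1))
  set order := ((preMachine P.coeff τ).run (mergeSort 0 (List.range (d + 1)))
    (heights P.coeff)).value with horder
  have hmem : ∀ k, k ∈ order ↔ k ≤ d := fun k => by
    rw [p1.mem_iff, List.mem_range]; omega
  have hempty : IsChain P.coeff 1 ∅ [] :=
    ⟨Or.inr rfl, by simp, by simp, by simp, by simp, by simp⟩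
  obtain ⟨s2, m2, t2, l2, H⟩ := run_buildHull (τ := τ) h0 hP order [] ∅ hempty
    (fun k hk => (hmem k).1 hk) (Or.inr ((hmem 0).2 (Nat.zero_le _))) (Or.inr ((hmem d).2 le_rfl))
    (by simp) o1
  have hset : (∅ ∪ {k | k ∈ order} : Set ℕ) = {k | k ≤ P.natDegree} := by
    ext k; simp [hmem, hdd]
  rw [hset] at H
  set verts := ((preMachine P.coeff τ).run (buildHull [] order) (heights P.coeff)).value
    with hverts
  have hlen : order.length = d + 1 := by rw [p1.length_eq, List.length_range]
  have h2 := H.two_le_length hd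
  have hvert : ∀ q < verts.length,
      concaveCover P (verts.getD q 0) = heights P.coeff (verts.getD q 0) :=
    fun q hq => H.cover_vertex hd hq
  obtain ⟨-, f1, f2, f3, f4, f5⟩ := run_scan P.coeff τ (fun k => concaveCover P k) verts
    (by omega) (fun q hq => by simpa using H.sorted q (q + 1) (by omega) hq)
    (fun q hq k hk1 hk2 => by
      rw [H.cover_eq hd hq (x := k) ⟨by exact_mod_cast hk1, by exact_mod_cast hk2⟩]
      exact line_congr (hvert q (by omega)) (hvert _ hq) _)
    (fun q hq => by
      rw [scale_eq_heights (H.mem q hq).2, EReal.coe_le_coe_iff, hvert q hq]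
      linarith)
    (heights P.coeff) (fun q hq => (hvert q hq).symm)
  rw [H.head_eq, H.last_eq, ← hdd] at f1 f2 f3 f5
  have act : ∀ n h, (preMachine P.coeff τ).onAct n h = h := fun n h => rfl
  have hrun : preRun P p = (preMachine P.coeff τ).run (precondition d) (heights P.coeff) := rfl
  simp only [precondition, run_bind, run_perform, run_pure, act, s1, s2, ← horder, ← hverts,
    f4] at hrun
  refine ⟨by rw [hrun], by rw [hrun]; exact H, fun k hk => ?_, fun k => ?_, ?_, ?_⟩
  · rw [hrun]
    change ((preMachine P.coeff τ).run (scan verts) (heights P.coeff)).state k = _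
    rw [f1, if_pos ⟨Nat.zero_le _, hk⟩]
  · rw [hrun]
    change k ∈ ((preMachine P.coeff τ).run (scan verts) (heights P.coeff)).value ↔ _
    rw [f2, goodIndices, Finset.mem_filter, Finset.mem_range, ← hdd, ← hτ, Nat.lt_succ_iff]
    simp
  · rw [hrun]
    intro n hn
    simp only [List.mem_append, List.mem_cons, List.not_mem_nil, or_false, false_or] at hn
    simp only [List.length_nil] at m2 l2
    rcases hn with hn | hn | hn
    · have := m1 n hn
      simpa using this
    · have := m2 n hn
      omega
    · omega
  · intro c hc1 hc2
    have ht1 := t1 c (by simp) (by simpa using hc1) (by simpa using hc2)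
    rw [List.length_range] at ht1
    rw [hlen, Finset.sum_range_succ'] at t2
    have e : ∑ k ∈ Finset.range d, (([] : List ℕ).length + (k + 1) - 1).size +
        (([] : List ℕ).length + 0 - 1).size = ∑ m ∈ Finset.range d, m.size := by simp
    rw [e] at t2
    rw [preTime, hrun]
    change _ + (_ + (_ + (0 + 0))) + _ ≤ _
    rw [← hdd]
    omega

/-- `m.size` bounds the number of tests of a binary search among `m + 1` positions. The sum is
`n c - 2 ^ c + 1` for any `c` with `n ≤ 2 ^ c ≤ 2 n`. -/
theorem sum_size_add_two_pow_le {n c : ℕ} (h1 : n ≤ 2 ^ c) (h2 : 2 ^ c ≤ 2 * n) :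
    ∑ m ∈ Finset.range n, m.size + 2 ^ c ≤ n * c + 1 := by
  induction n generalizing c with
  | zero => simp at h2
  | succ n ih =>
    rw [Finset.sum_range_succ]
    have hsize : n.size ≤ c := Nat.size_le.2 h1
    have e : (n + 1) * c = n * c + c := by ring
    by_cases h : 2 ^ c ≤ 2 * n
    · have := ih (by omega) h
      omega
    · rcases c with _ | c
      · have : n = 0 := by simp at h1; omega
        subst this; simp
      · rw [pow_succ'] at h1 h2 h ⊢
        have hn : 2 ^ c = n + 1 := by omega
        rcases Nat.eq_zero_or_pos n with rfl | hn0
        · have : c = 0 := by simpa using hn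
          subst this; simp
        · have := ih (c := c) (by omega) (by
            have : 2 ^ c ≠ 1 := by omega
            rcases c with _ | c
            · simp at this
            · rw [pow_succ'] at hn ⊢; omega)
          have hsize' : n.size ≤ c := Nat.size_le.2 (by omega)
          have e' : (n + 1) * (c + 1) = n * c + c + n + 1 := by ring
          omega

theorem preTime_le {P : ℂ[X]} (p : ℕ) (hd : 1 ≤ P.natDegree) (h0 : P.coeff 0 ≠ 0) :
    (preTime P p : ℝ) ≤ P.natDegree + 2 * P.natDegree * Real.logb 2 P.natDegree := by
  have ht := (preSpec p hd h0).tests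
  set d := P.natDegree
  set k := Nat.log 2 d with hk
  have hk1 : 2 ^ k ≤ d := Nat.pow_log_le_self 2 (by omega)
  have hk2 : d < 2 ^ (k + 1) := Nat.lt_pow_succ_log_self (by norm_num) d
  have hk3 : k + 2 ≤ 2 * 2 ^ k := by
    have : k < 2 ^ k := Nat.lt_two_pow_self
    have := Nat.one_le_two_pow (n := k)
    omega
  have e : 2 ^ (k + 1) = 2 * 2 ^ k := pow_succ' 2 k
  have h1 := ht (k + 1) hk2 (by omega)
  have h2 := sum_size_add_two_pow_le hk2.le (by omega)
  have hnat : preTime P p + 4 * 2 ^ k + 1 ≤ 2 * d * k + 3 * d + k + 3 := by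
    have e1 : (d + 1) * (k + 1) = d * k + d + k + 1 := by ring
    have e2 : d * (k + 1) = d * k + d := by ring
    have e3 : 2 * d * k = d * k + d * k := by ring
    omega
  -- `log₂ d ≥ k + (d / 2 ^ k - 1)` by concavity of the logarithm on `[2 ^ k, 2 ^ (k + 1)]`
  have hlog : (k : ℝ) + (d / 2 ^ k - 1) ≤ Real.logb 2 d := by
    set x : ℝ := d / 2 ^ k - 1 with hx
    have hpow : (0 : ℝ) < 2 ^ k := by positivity
    have hx0 : 0 ≤ x := by
      rw [hx, sub_nonneg, le_div_iff₀ hpow, one_mul]; exact_mod_cast hk1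
    have hx1 : x ≤ 1 := by
      rw [hx, sub_le_iff_le_add, div_le_iff₀ hpow]
      have : (d : ℝ) ≤ (2 : ℝ) ^ (k + 1) := by exact_mod_cast hk2.le
      rw [pow_succ'] at this
      linarith
    have hdx : (d : ℝ) = 2 ^ k * (1 + x) := by rw [hx]; field_simp; ring
    rw [Real.le_logb_iff_rpow_le (by norm_num) (by exact_mod_cast hd),
      Real.rpow_add (by norm_num), Real.rpow_natCast]
    conv_rhs => rw [hdx]
    refine mul_le_mul_of_nonneg_left ?_ hpow.le
    have := rpow_one_add_le_one_add_mul_self (s := (1 : ℝ)) (by norm_num) hx0 hx1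
    norm_num at this
    linarith
  have hreal : (preTime P p : ℝ) + 4 * 2 ^ k + 1 ≤ 2 * d * k + 3 * d + k + 3 := by
    exact_mod_cast hnat
  have hk3' : (k : ℝ) + 2 ≤ 2 * 2 ^ k := by exact_mod_cast hk3
  have hk1' : (2 : ℝ) ^ k ≤ d := by exact_mod_cast hk1
  have hpow : (0 : ℝ) < 2 ^ k := by positivity
  have hx : (d : ℝ) - 2 ^ k ≤ d * (d / 2 ^ k - 1) := by
    have : (d : ℝ) * (d / 2 ^ k - 1) - (d - 2 ^ k) = (d - 2 ^ k) ^ 2 / 2 ^ k := by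
      field_simp
    have h3 : (0 : ℝ) ≤ (d - 2 ^ k) ^ 2 / 2 ^ k := by positivity
    linarith
  have hfin := mul_le_mul_of_nonneg_left hlog (show (0 : ℝ) ≤ d by positivity)
  rw [mul_add] at hfin
  linarith

theorem preMemory_le (w : ℕ) {P : ℂ[X]} {p : ℕ} (hp : 1 ≤ p) (hd : 1 ≤ P.natDegree)
    (h0 : P.coeff 0 ≠ 0) :
    (preMemory w P p : ℝ) ≤ (8 + 12 * w : ℕ) * (P.natDegree * p) := by
  have hm := (preSpec p hd h0).memory
  have hfold : ∀ (l : List ℕ) (B : ℕ), (∀ n ∈ l, n ≤ B) → l.foldr max 0 ≤ B := by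
    intro l B hl
    induction l with
    | nil => simp
    | cons x l ih =>
      simp only [List.foldr_cons, max_le_iff]
      exact ⟨hl x (by simp), ih fun n hn => hl n (List.mem_cons_of_mem _ hn)⟩
  have h1 := hfold _ _ hm
  have h2 : preMemory w P p ≤ (8 + 12 * w) * (P.natDegree * p) := by
    rw [preMemory]
    have e1 : 2 * (P.natDegree + 1) * (p + 1) ≤ 8 * (P.natDegree * p) := by nlinarith
    have e2 : 4 * (P.natDegree + 1) + (preRun P p).acts.foldr max 0 ≤
        12 * (P.natDegree * p) := by nlinarith
    have e3 := Nat.mul_le_mul_left w e2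
    nlinarith
  exact_mod_cast h2

/-! ### Searches of the evaluation phase -/

section Search

variable (F : Arithmetic) (a : ℕ → ℂ) (h : ℕ → ℝ) (τ : ℝ) (z : ℂ)

/-- The first step of `findTop`, which computes `λ`, branches like the first step of a binary search
in the state where `λ` is known. -/
theorem run_findTop (v : List ℕ) (hv : 2 ≤ v.length) (s : EvalState) :
    ∃ j ≤ v.length - 1,
      ((evalMachine F a h τ z).run (findTop v) s).value = v.getD j 0 ∧
      ((evalMachine F a h τ z).run (findTop v) s).state = { s with lam := Real.logb 2 ‖z‖ } ∧
      ((evalMachine F a h τ z).run (findTop v) s).acts = [] ∧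
      ((evalMachine F a h τ z).run (findTop v) s).tests ≤ (v.length - 1).size ∧
      (j = 0 ∨ -Real.logb 2 ‖z‖ < (h (v.getD j 0) - h (v.getD (j - 1) 0)) /
        ((v.getD j 0 : ℝ) - v.getD (j - 1) 0)) ∧
      (j = v.length - 1 ∨ (h (v.getD (j + 1) 0) - h (v.getD j 0)) /
        ((v.getD (j + 1) 0 : ℝ) - v.getD j 0) ≤ -Real.logb 2 ‖z‖) := by
  set m := v.length - 1 with hm
  have hm0 : m ≠ 0 := by omega
  set s' : EvalState := { s with lam := Real.logb 2 ‖z‖ } with hs'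
  have key : (evalMachine F a h τ z).run
      (.test (.setScale (v.getD (m / 2) 0) (v.getD (m / 2 + 1) 0)) fun b =>
        if b then bisect (fun j => EvalTest.slope (v.getD j 0) (v.getD (j + 1) 0))
          (m - m / 2 - 1) (m / 2 + 1)
        else bisect (fun j => EvalTest.slope (v.getD j 0) (v.getD (j + 1) 0)) (m / 2) 0) s =
      (evalMachine F a h τ z).run
        (bisect (fun j => EvalTest.slope (v.getD j 0) (v.getD (j + 1) 0)) m 0) s' := by
    rw [bisect.eq_def _ m 0, if_neg hm0, run_test, run_test]
    simp only [zero_add]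
    rfl
  obtain ⟨h1, h2, h3, -, h5, h6, h7⟩ := run_bisect (evalMachine F a h τ z) s'
    (fun j => EvalTest.slope (v.getD j 0) (v.getD (j + 1) 0)) (fun j => rfl) m 0
  refine ⟨((evalMachine F a h τ z).run
    (bisect (fun j => EvalTest.slope (v.getD j 0) (v.getD (j + 1) 0)) m 0) s').value,
    by omega, ?_⟩
  simp only [findTop, ← hm, if_neg hm0, run_bind, key, run_pure, h1, h2]
  refine ⟨trivial, trivial, rfl, by simpa using h3, ?_, ?_⟩
  · set j := ((evalMachine F a h τ z).run
      (bisect (fun j => EvalTest.slope (v.getD j 0) (v.getD (j + 1) 0)) m 0) s').value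
    by_cases h0 : j = 0
    · exact Or.inl h0
    · have := h6.resolve_left h0
      rw [Nat.sub_add_cancel (Nat.pos_of_ne_zero h0)] at this
      exact Or.inr (of_decide_eq_true this)
  · refine h7.imp (fun h => by simpa using h) fun h => ?_
    exact not_lt.1 (of_decide_eq_false h)

theorem run_findLeft (k : ℕ) (s : EvalState) (hs : k = 0 → s.top = h 0) :
    ∃ l ≤ k,
      ((evalMachine F a h τ z).run (findLeft k) s).value = l ∧
      ((evalMachine F a h τ z).run (findLeft k) s).state =
        { s with top := h k + s.lam * k } ∧
      ((evalMachine F a h τ z).run (findLeft k) s).acts = [] ∧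
      ((evalMachine F a h τ z).run (findLeft k) s).tests ≤
        (if k = 0 then 0 else (k - 1).size + 1) ∧
      (l = 0 ∨ ¬ h k + s.lam * k - τ ≤ h (l - 1) + s.lam * (l - 1 : ℕ)) ∧
      (l = k ∨ h k + s.lam * k - τ ≤ h l + s.lam * l) := by
  rw [findLeft]
  split_ifs with hk
  · refine ⟨0, by omega, rfl, ?_, rfl, le_rfl, Or.inl rfl, Or.inl hk.symm⟩
    have : s.top = h k + s.lam * k := by rw [hs hk, hk]; simp
    rw [← this, run_ret]
  · set s' : EvalState := { s with top := h k + s.lam * k } with hs'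
    have ht : (evalMachine F a h τ z).onTest (.setTop k) s =
      (decide (h k + s.lam * k - τ ≤ h 0), s') := rfl
    rw [run_test, ht]
    by_cases hb : h k + s.lam * k - τ ≤ h 0
    · simp only [hb, decide_true, if_true, run_ret]
      exact ⟨0, Nat.zero_le _, rfl, trivial, trivial, by omega, Or.inl rfl,
        Or.inr (by simpa using hb)⟩
    · simp only [hb, decide_false, Bool.false_eq_true, if_false]
      obtain ⟨h1, h2, h3, h4, h5, h6, h7⟩ := run_bisect (evalMachine F a h τ z) s'
        EvalTest.outStrip (fun j => rfl) (k - 1) 1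
      refine ⟨_, by omega, rfl, h1, h2, by omega, Or.inr ?_, ?_⟩
      · rcases h6 with h6 | h6
        · rw [h6]; simpa using hb
        · exact of_decide_eq_true h6
      · rcases h7 with h7 | h7
        · left; omega
        · exact Or.inr (not_not.1 (of_decide_eq_false h7))

theorem run_findRight {d k : ℕ} (hk : k ≤ d) (s : EvalState) :
    ∃ r, k ≤ r ∧ r ≤ d ∧
      ((evalMachine F a h τ z).run (findRight d k) s).value = r ∧
      ((evalMachine F a h τ z).run (findRight d k) s).state = s ∧
      ((evalMachine F a h τ z).run (findRight d k) s).acts = [] ∧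
      ((evalMachine F a h τ z).run (findRight d k) s).tests ≤ (d - k).size ∧
      (r = k ∨ s.top - τ ≤ h r + s.lam * r) ∧
      (r = d ∨ ¬ s.top - τ ≤ h (r + 1) + s.lam * (r + 1 : ℕ)) := by
  obtain ⟨h1, h2, h3, h4, h5, h6, h7⟩ := run_bisect (evalMachine F a h τ z) s
    EvalTest.inStrip (fun j => rfl) (d - k) (k + 1)
  simp only [findRight, run_bind, run_pure, h1, h2]
  refine ⟨_, ?_, ?_, rfl, trivial, rfl, by simpa using h3, ?_, ?_⟩
  · omega
  · omega
  · rcases h6 with h6 | h6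
    · left; omega
    · exact Or.inr (of_decide_eq_true h6)
  · rcases h7 with h7 | h7
    · left; omega
    · right
      have := of_decide_eq_false h7
      rwa [Nat.sub_add_cancel (by omega)]

end Search

/-! ### High precision arithmetic -/

section Arith

variable {F : Arithmetic} {a : ℕ → ℂ} {h : ℕ → ℝ} {τ : ℝ} {z : ℂ}

theorem onAct_toAcc (x y u : Operand) (s : EvalState) :
    (evalMachine F a h τ z).onAct (.toAcc x y u) s =
      { s with acc := F.mulAdd (x.value F a z s) (y.value F a z s) (u.value F a z s) } := rfl

theorem onAct_toPow (x y u : Operand) (s : EvalState) :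
    (evalMachine F a h τ z).onAct (.toPow x y u) s =
      { s with pow := F.mulAdd (x.value F a z s) (y.value F a z s) (u.value F a z s) } := rfl

theorem value_zero (s : EvalState) : Operand.zero.value F a z s = 0 := rfl

theorem value_acc (s : EvalState) : Operand.acc.value F a z s = s.acc := rfl

theorem value_pow (s : EvalState) : Operand.pow.value F a z s = s.pow := rfl

theorem value_point (s : EvalState) : Operand.point.value .exact a z s = z := rfl

theorem mulAdd_exact (x y u : ℂ) : Arithmetic.exact.mulAdd x y u = x * y + u := rfl

theorem run_power (n : ℕ) (hn : 1 ≤ n) (s : EvalState) :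
    ((evalMachine F a h τ z).run (power n) s).tests = 0 ∧
    ((evalMachine F a h τ z).run (power n) s).acts.length ≤ n - 1 ∧
    ((evalMachine F a h τ z).run (power n) s).acts.length ≤ 2 * Nat.log 2 n ∧
    ((evalMachine F a h τ z).run (power n) s).state.acc = s.acc ∧
    (F = Arithmetic.exact → ((evalMachine F a h τ z).run (power n) s).value.value F a z
      ((evalMachine F a h τ z).run (power n) s).state = z ^ n) := by
  induction n using Nat.strong_induction_on generalizing s with
  | _ n ih =>
    rw [power]
    have hlog : ¬ n ≤ 1 → Nat.log 2 n = Nat.log 2 (n / 2) + 1 := fun h1 =>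
      Nat.log_of_one_lt_of_le (by norm_num) (by omega)
    split_ifs with h1 h2
    · obtain rfl : n = 1 := by omega
      simp only [run_ret]
      refine ⟨trivial, by simp, by simp, trivial, ?_⟩
      rintro rfl
      rw [value_point, pow_one]
    · obtain ⟨t1, m1, m2, c1, v1⟩ := ih (n / 2) (by omega) (by omega) s
      have hlog := hlog h1
      simp only [run_bind, run_perform, run_pure, List.length_append, List.length_cons,
        List.length_nil, t1, onAct_toPow]
      refine ⟨trivial, by omega, by omega, c1, ?_⟩
      rintro rfl
      have : n = n / 2 + n / 2 + 1 := by omega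
      conv_rhs => rw [this, pow_succ, pow_add, ← v1 rfl]
      simp only [value_pow, value_zero, value_point, mulAdd_exact, add_zero]
    · obtain ⟨t1, m1, m2, c1, v1⟩ := ih (n / 2) (by omega) (by omega) s
      have hlog := hlog h1
      simp only [run_bind, run_perform, run_pure, List.length_append, List.length_cons,
        List.length_nil, t1, onAct_toPow]
      refine ⟨trivial, by omega, by omega, c1, ?_⟩
      rintro rfl
      have : n = n / 2 + n / 2 := by omega
      conv_rhs => rw [this, pow_add, ← v1 rfl]
      simp only [value_pow, value_zero, mulAdd_exact, add_zero]

theorem run_horner (G : List ℕ) (l n : ℕ) (x : Operand) (hx : x ≠ .pow) (s : EvalState) :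
    ((evalMachine F a h τ z).run (horner G l n x) s).tests = 0 ∧
    ((evalMachine F a h τ z).run (horner G l n x) s).acts.length = n ∧
    ((evalMachine F a h τ z).run (horner G l n x) s).value ≠ .pow ∧
    (F = Arithmetic.exact → ((evalMachine F a h τ z).run (horner G l n x) s).value.value F a z
      ((evalMachine F a h τ z).run (horner G l n x) s).state =
        x.value F a z s * z ^ n +
          ∑ i ∈ Finset.range n, (if l + i ∈ G then a (l + i) else 0) * z ^ i) := by
  induction n generalizing x s with
  | zero => simp [horner, hx]
  | succ n ih =>
    obtain ⟨h1, h2, h3, h4⟩ := ih .acc (by simp) ((evalMachine F a h τ z).onAct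
      (.toAcc x .point (term G (l + n))) s)
    rw [horner, run_act]
    refine ⟨h1, by simp [h2], h3, fun hF => ?_⟩
    rw [h4 hF, Finset.sum_range_succ]
    subst hF
    have hterm : (term G (l + n)).value Arithmetic.exact a z s =
        if l + n ∈ G then a (l + n) else 0 := by
      unfold term; split_ifs <;> rfl
    rw [onAct_toAcc, value_acc, value_point, mulAdd_exact, hterm]
    ring

theorem value_congr {x : Operand} (hx : x ≠ .pow) {s s' : EvalState} (hs : s.acc = s'.acc) :
    x.value F a z s = x.value F a z s' := by
  cases x <;> simp_all [Operand.value]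

theorem run_evalReduced (G : List ℕ) {l r : ℕ} (hlr : l ≤ r) (s : EvalState) :
    ((evalMachine F a h τ z).run (evalReduced G l r) s).tests = 0 ∧
    ((evalMachine F a h τ z).run (evalReduced G l r) s).acts.length ≤ r ∧
    ((evalMachine F a h τ z).run (evalReduced G l r) s).acts.length ≤
      r - l + 1 + 2 * Nat.log 2 l ∧
    (F = Arithmetic.exact →
      ((evalMachine F a h τ z).run (evalReduced G l r) s).value.value F a z
        ((evalMachine F a h τ z).run (evalReduced G l r) s).state =
        ∑ k ∈ Finset.Icc l r, (if k ∈ G then a k else 0) * z ^ k) := by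
  have hx : term G r ≠ .pow := by unfold term; split_ifs <;> simp
  obtain ⟨t1, m1, n1, v1⟩ := run_horner (F := F) (a := a) (h := h) (τ := τ) (z := z) G l (r - l)
    (term G r) hx s
  have hsum : ∑ k ∈ Finset.Icc l r, (if k ∈ G then a k else 0) * z ^ k =
      z ^ l * ((if r ∈ G then a r else 0) * z ^ (r - l) + ∑ i ∈ Finset.range (r - l),
        (if l + i ∈ G then a (l + i) else 0) * z ^ i) := by
    have hIcc : Finset.Icc l r = Finset.Ico l (r + 1) := by
      ext k; simp only [Finset.mem_Icc, Finset.mem_Ico]; omega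
    rw [hIcc, Finset.sum_Ico_eq_sum_range, show r + 1 - l = r - l + 1 by omega,
      Finset.sum_range_succ, Nat.add_sub_cancel' hlr, mul_add, Finset.mul_sum, add_comm]
    congr 1
    · conv_lhs => rw [← Nat.add_sub_cancel' hlr, pow_add]
      rw [Nat.add_sub_cancel' hlr]
      ring
    · exact Finset.sum_congr rfl fun i _ => by rw [pow_add]; ring
  have hterm : F = Arithmetic.exact → (term G r).value F a z s = if r ∈ G then a r else 0 := by
    rintro rfl
    unfold term; split_ifs <;> rfl
  by_cases hl : l = 0
  · simp only [evalReduced, hl, if_true, run_bind, run_pure]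
    subst hl
    refine ⟨t1, ?_, ?_, fun hF => ?_⟩
    · rw [List.append_nil, m1]; omega
    · rw [List.append_nil, m1]; omega
    rw [v1 hF, hterm hF, hsum, pow_zero, one_mul]
  · obtain ⟨t2, m2, m3, c2, v2⟩ := run_power (F := F) (a := a) (h := h) (τ := τ) (z := z) l
      (by omega) ((evalMachine F a h τ z).run (horner G l (r - l) (term G r)) s).state
    simp only [evalReduced, hl, if_false, run_bind, run_perform, run_pure, t1, t2,
      List.length_append, List.length_cons, List.length_nil, m1]
    refine ⟨by simp, by omega, by omega, fun hF => ?_⟩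
    have hv1 := v1 hF
    have hv2 := v2 hF
    rw [value_congr n1 c2.symm] at hv1
    rw [hsum, ← hterm hF, ← hv1, ← hv2]
    subst hF
    rw [onAct_toAcc, value_acc, value_zero, mulAdd_exact]
    ring

end Arith

/-! ### The evaluation phase -/

theorem two_pow_size_add_size_le {x y d : ℕ} (h : x + y + 1 = d) :
    2 ^ (x.size + y.size) ≤ d ^ 2 := by
  have key : ∀ n : ℕ, n ≠ 0 → 2 ^ n.size ≤ 2 * n := by
    intro n hn
    have hpos : 0 < n.size := Nat.size_pos.2 (Nat.pos_of_ne_zero hn)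
    have := Nat.lt_size.1 (show n.size - 1 < n.size by omega)
    have e : 2 ^ n.size = 2 * 2 ^ (n.size - 1) := by
      rw [← pow_succ', Nat.sub_add_cancel hpos]
    omega
  rw [pow_add]
  rcases Nat.eq_zero_or_pos x with rfl | hx <;> rcases Nat.eq_zero_or_pos y with rfl | hy
  · subst h; simp
  · have := key y hy.ne'
    simp only [Nat.size_zero, pow_zero, one_mul]
    nlinarith
  · have := key x hx.ne'
    simp only [Nat.size_zero, pow_zero, mul_one]
    nlinarith
  · have := Nat.mul_le_mul (key x hx.ne') (key y hy.ne')
    refine this.trans ?_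
    subst h
    nlinarith [sq_nonneg ((x : ℤ) - y), mul_self_nonneg ((x : ℤ) - y), sq_nonneg (x + y),
      four_mul_le_sq_add x y]

theorem natLog_le_logb {d : ℕ} (hd : 1 ≤ d) : (Nat.log 2 d : ℝ) ≤ Real.logb 2 d := by
  rw [Real.le_logb_iff_rpow_le (by norm_num) (by exact_mod_cast hd), Real.rpow_natCast]
  exact_mod_cast Nat.pow_log_le_self 2 (by omega)

/-- The searches for the two edges of the window share a range of `d - 1` positions. -/
theorem search_tests_le {d m k : ℕ} (hd : 1 ≤ d) (hm : m ≤ d) (hk : k ≤ d) :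
    ((m.size + ((if k = 0 then 0 else (k - 1).size + 1) + (d - k).size) : ℕ) : ℝ) ≤
      2 + 3 * Real.logb 2 d := by
  have hlog := natLog_le_logb hd
  have hsize : ∀ n ≤ d, n.size ≤ Nat.log 2 d + 1 := fun n hn =>
    Nat.size_le.2 (hn.trans_lt (Nat.lt_pow_succ_log_self (by norm_num) d))
  have hlog0 : 0 ≤ Real.logb 2 d := Real.logb_nonneg (by norm_num) (by exact_mod_cast hd)
  have h1 : (m.size : ℝ) ≤ Nat.log 2 d + 1 := by exact_mod_cast hsize m hm
  split_ifs with h0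
  · have h2 : ((d - k).size : ℝ) ≤ Nat.log 2 d + 1 := by exact_mod_cast hsize _ (by omega)
    push_cast
    linarith
  · have h2 := two_pow_size_add_size_le (show k - 1 + (d - k) + 1 = d by omega)
    have h3 : (((k - 1).size + (d - k).size : ℕ) : ℝ) ≤ 2 * Real.logb 2 d := by
      rw [← Nat.cast_ofNat (R := ℝ), ← Real.logb_pow, Nat.cast_ofNat,
        Real.le_logb_iff_rpow_le (by norm_num) (by positivity), Real.rpow_natCast]
      exact_mod_cast h2
    push_cast at h3 ⊢
    linarith

/-- `Ê_P + λ Id`. -/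
def tilt (P : ℂ[X]) (lam x : ℝ) : ℝ := concaveCover P x + lam * x

theorem IsChain.concaveOn_tilt {P : ℂ[X]} {c : List ℕ}
    (H : IsChain P.coeff 1 {k | k ≤ P.natDegree} c) (hd : 1 ≤ P.natDegree) (lam : ℝ) :
    ConcaveOn ℝ (Set.Icc (0 : ℝ) P.natDegree) (tilt P lam) := by
  refine (H.concaveOn_cover hd).add ⟨convex_Icc _ _, fun x _ y _ α β _ _ _ => le_of_eq ?_⟩
  simp only [smul_eq_mul]
  ring

/-- A vertex at which the slopes of the concave cover cross `-λ` maximizes `Ê_P + λ Id`. -/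
theorem IsChain.isMax_tilt {P : ℂ[X]} {c : List ℕ}
    (H : IsChain P.coeff 1 {k | k ≤ P.natDegree} c) (hd : 1 ≤ P.natDegree) {lam : ℝ} {j : ℕ}
    (hj : j ≤ c.length - 1)
    (hleft : j = 0 ∨ -lam < (concaveCover P (c.getD j 0) - concaveCover P (c.getD (j - 1) 0)) /
        ((c.getD j 0 : ℝ) - c.getD (j - 1) 0))
    (hright : j = c.length - 1 ∨
      (concaveCover P (c.getD (j + 1) 0) - concaveCover P (c.getD j 0)) /
        ((c.getD (j + 1) 0 : ℝ) - c.getD j 0) ≤ -lam) {x : ℝ}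
    (hx : x ∈ Set.Icc (0 : ℝ) P.natDegree) : tilt P lam x ≤ tilt P lam (c.getD j 0) := by
  have hpos := H.length_pos
  rcases le_total x (c.getD j 0) with hxj | hxj
  · by_cases h0 : j = 0
    · rw [h0, H.head_eq] at hxj ⊢
      rw [le_antisymm hxj (by simpa using hx.1)]
    · have hs := hleft.resolve_left h0
      have hle := H.cover_le hd (j := j - 1) (by omega) hx
      rw [Nat.sub_add_cancel (by omega), line_swap _ (H.ne (by omega) (by omega)), line] at hle
      rw [H.cover_vertex hd (by omega), H.cover_vertex hd (by omega), ← neg_sub (heights _ _),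
        ← neg_sub (c.getD (j - 1) 0 : ℝ), neg_div_neg_eq] at hs
      simp only [tilt]
      rw [H.cover_vertex hd (by omega)]
      nlinarith
  · by_cases h0 : j = c.length - 1
    · rw [h0, H.last_eq] at hxj ⊢
      rw [le_antisymm hx.2 hxj]
    · have hs := hright.resolve_left h0
      have hle := H.cover_le hd (j := j) (by omega) hx
      rw [line] at hle
      rw [H.cover_vertex hd (by omega), H.cover_vertex hd (by omega)] at hs
      simp only [tilt]
      rw [H.cover_vertex hd (by omega)]
      nlinarith

theorem mem_window_iff {P : ℂ[X]} {p : ℕ} {z : ℂ} {K k : ℕ} (hK : K ≤ P.natDegree)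
    (hmax : ∀ x ∈ Set.Icc (0 : ℝ) P.natDegree,
      tilt P (Real.logb 2 ‖z‖) x ≤ tilt P (Real.logb 2 ‖z‖) K) :
    k ∈ window P p z ↔ k ≤ P.natDegree ∧
      tilt P (Real.logb 2 ‖z‖) K - thickness P.natDegree p ≤ tilt P (Real.logb 2 ‖z‖) k := by
  simp only [window, Finset.mem_filter, Finset.mem_range, Nat.lt_succ_iff]
  refine and_congr_right fun _ => ⟨fun h => h K ⟨Nat.cast_nonneg _, by exact_mod_cast hK⟩,
    fun h x hx => ?_⟩
  exact (sub_le_sub_right (hmax x hx) _).trans h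

theorem IsChain.length_le {P : ℂ[X]} {c : List ℕ}
    (H : IsChain P.coeff 1 {k | k ≤ P.natDegree} c) : c.length - 1 ≤ P.natDegree := by
  have key : ∀ j < c.length, j ≤ c.getD j 0 := by
    intro j
    induction j with
    | zero => intro _; exact Nat.zero_le _
    | succ j ih =>
      intro hj
      have h1 : c.getD j 0 < c.getD (j + 1) 0 := by
        simpa using H.sorted j (j + 1) (Nat.lt_succ_self j) hj
      have := ih (by omega)
      omega
  have := key (c.length - 1) (by have := H.length_pos; omega)
  rwa [H.last_eq] at this

/-- The run of the evaluation phase: the window is an interval `⟦l, r⟧`, found within the claimed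
number of tests, and Hörner's method with repeated squaring costs at most `r - l + 1 + 2 log₂ l`
actions. -/
theorem evalRun_spec {P : ℂ[X]} (p : ℕ) (hd : 1 ≤ P.natDegree) (h0 : P.coeff 0 ≠ 0)
    (F : Arithmetic) (z : ℂ) :
    ∃ l r, l ≤ r ∧ r ≤ P.natDegree ∧ window P p z = Finset.Icc l r ∧
      ((evalRun F P p z).tests : ℝ) ≤ 2 + 3 * Real.logb 2 P.natDegree ∧
      (evalRun F P p z).acts.length ≤ r ∧
      (evalRun F P p z).acts.length ≤ r - l + 1 + 2 * Nat.log 2 l ∧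
      (F = Arithmetic.exact → evalOutput F P p z = reducedValue P p z) := by
  obtain ⟨hdeg, H, hstate, hgood, -, -⟩ := preSpec p hd h0
  set D := (preRun P p).value with hD
  set h := (preRun P p).state with hh
  set d := P.natDegree with hdd
  set τ := thickness d p with hτ
  have hτ0 : 0 ≤ τ := thickness_nonneg hd p
  set lam := Real.logb 2 ‖z‖ with hlam
  set m := evalMachine F P.coeff h τ z with hm
  set s0 : EvalState := ⟨0, h 0, 0, 0⟩ with hs0
  have hrun : evalRun F P p z = m.run (evaluation D) s0 := rfl
  have h2 := H.two_le_length hd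
  have hvle : ∀ j < D.verts.length, D.verts.getD j 0 ≤ d := fun j hj => (H.mem j hj).1
  obtain ⟨j, hj, v1, st1, ac1, te1, hl1, hr1⟩ := run_findTop F P.coeff h τ z D.verts h2 s0
  rw [← hm] at v1 st1 ac1 te1
  have hKd : D.verts.getD j 0 ≤ d := hvle j (by omega)
  have hmax : ∀ x ∈ Set.Icc (0 : ℝ) d, tilt P lam x ≤ tilt P lam (D.verts.getD j 0) := by
    intro x hx
    refine H.isMax_tilt hd hj ?_ ?_ hx
    · refine hl1.imp id fun h' => ?_
      rwa [hstate _ hKd, hstate _ (hvle (j - 1) (by omega))] at h'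
    · by_cases hj' : j = D.verts.length - 1
      · exact Or.inl hj'
      · have h' := hr1.resolve_left hj'
        rw [hstate _ hKd, hstate _ (hvle (j + 1) (by omega))] at h'
        exact Or.inr h'
  set K := D.verts.getD j 0 with hK
  set s1 : EvalState := { s0 with lam := lam } with hs1
  obtain ⟨l, hlK, v2, st2, ac2, te2, hl2, hr2⟩ := run_findLeft F P.coeff h τ z K s1
    (fun _ => rfl)
  rw [← hm] at v2 st2 ac2 te2
  set s2 : EvalState := { s1 with top := h K + s1.lam * K } with hs2
  obtain ⟨r, hKr, hrd, v3, st3, ac3, te3, hl3, hr3⟩ := run_findRight F P.coeff h τ z hKd s2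
  rw [← hm] at v3 st3 ac3 te3
  obtain ⟨te4, ac4, ac4', out4⟩ := run_evalReduced (F := F) (a := P.coeff) (h := h) (τ := τ)
    (z := z) D.good (hlK.trans hKr) s2
  rw [← hm] at te4 ac4 ac4' out4
  simp only [evaluation, run_bind, v1, st1, ac1, v2, st2, ac2, hdeg, v3, st3, ac3, te4,
    List.nil_append] at hrun
  -- the tests of the searches in terms of `tilt`
  have htilt : ∀ k ≤ d, h k + lam * k = tilt P lam k := fun k hk => by rw [hstate k hk, tilt]
  have hwin : window P p z = Finset.Icc l r := by
    have hin : ∀ k, k ∈ window P p z ↔ k ≤ d ∧ tilt P lam K - τ ≤ tilt P lam k :=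
      fun k => mem_window_iff hKd hmax
    have hinK : K ∈ window P p z := (hin K).2 ⟨hKd, by linarith⟩
    have hl : l ∈ window P p z := by
      rcases hr2 with rfl | h'
      · exact hinK
      · rw [show s1.lam = lam from rfl, htilt K hKd, htilt l (hlK.trans hKd)] at h'
        exact (hin l).2 ⟨hlK.trans hKd, h'⟩
    have hr : r ∈ window P p z := by
      rcases hl3 with rfl | h'
      · exact hinK
      · rw [show s2.lam = lam from rfl, show s2.top = h K + lam * K from rfl, htilt K hKd,
          htilt r hrd] at h'
        exact (hin r).2 ⟨hrd, h'⟩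
    have hl' : l = 0 ∨ l - 1 ∉ window P p z := by
      refine hl2.imp id fun h' hmem => h' ?_
      rw [show s1.lam = lam from rfl, htilt K hKd, htilt (l - 1) (by omega)]
      exact ((hin _).1 hmem).2
    have hr' : r = d ∨ r + 1 ∉ window P p z := by
      by_cases hrd' : r = d
      · exact Or.inl hrd'
      · refine Or.inr fun hmem => hr3.resolve_left hrd' ?_
        rw [show s2.lam = lam from rfl, show s2.top = h K + lam * K from rfl, htilt K hKd,
          htilt (r + 1) (by omega)]
        exact ((hin _).1 hmem).2
    have hconv : ∀ x y k, x ∈ window P p z → y ∈ window P p z → x ≤ k → k ≤ y →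
        k ∈ window P p z := by
      intro x y k hx hy hxk hky
      rw [hin] at hx hy ⊢
      refine ⟨hky.trans hy.1, (le_min hx.2 hy.2).trans ?_⟩
      exact (H.concaveOn_tilt hd lam).min_le_of_mem_Icc
        ⟨Nat.cast_nonneg _, by exact_mod_cast hx.1⟩ ⟨Nat.cast_nonneg _, by exact_mod_cast hy.1⟩
        ⟨by exact_mod_cast hxk, by exact_mod_cast hky⟩
    ext k
    rw [Finset.mem_Icc]
    constructor
    · intro hk
      constructor
      · by_contra hlt
        exact hl'.resolve_left (by omega)
          (hconv k l (l - 1) hk hl (by omega) (by omega))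
      · by_contra hlt
        have hkd := ((hin k).1 hk).1
        exact hr'.resolve_left (by omega)
          (hconv r k (r + 1) hr hk (by omega) (by omega))
    · exact fun hk => hconv l r k hl hr hk.1 hk.2
  refine ⟨l, r, hlK.trans hKr, hrd, hwin, ?_, ?_, ?_, fun hF => ?_⟩
  · refine le_trans ?_ (search_tests_le hd H.length_le hKd)
    rw [hrun]
    exact_mod_cast (by omega : (m.run (findTop D.verts) s0).tests +
      ((m.run (findLeft K) s1).tests + ((m.run (findRight d K) s2).tests + 0)) ≤ _)
  · rw [hrun]; exact ac4
  · rw [hrun]; exact ac4'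
  · rw [evalOutput, hrun, out4 hF, reducedValue, hwin]
    simp only [ite_mul, zero_mul]
    rw [← Finset.sum_filter]
    refine Finset.sum_congr ?_ fun _ _ => rfl
    ext k
    rw [Finset.mem_filter, Finset.mem_inter, hgood, and_comm]

/-! ### Measurability of the evaluation time -/

/-- Measurability of the cost of a run: a program is a finite decision tree whose tests compare
measurable functions of `λ`. The arithmetic `F` may be arbitrary, since no test reads its results. -/
theorem measurable_run {Ω : Type*} [MeasurableSpace Ω] (F : Arithmetic) (a : ℕ → ℂ) (h : ℕ → ℝ)
    (τ : ℝ) {z : Ω → ℂ} (hz : Measurable fun ω => Real.logb 2 ‖z ω‖) {α : Type}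
    (q : EvalProg α) (s : Ω → EvalState) (hlam : Measurable fun ω => (s ω).lam)
    (htop : Measurable fun ω => (s ω).top) :
    (Measurable fun ω => ((evalMachine F a h τ (z ω)).run q (s ω)).tests) ∧
    Measurable fun ω => ((evalMachine F a h τ (z ω)).run q (s ω)).acts.length := by
  induction q generalizing s with
  | ret a => simp
  | test t q ih =>
    have key : (MeasurableSet {ω | ((evalMachine F a h τ (z ω)).onTest t (s ω)).1 = true}) ∧
        (Measurable fun ω => ((evalMachine F a h τ (z ω)).onTest t (s ω)).2.lam) ∧
        Measurable fun ω => ((evalMachine F a h τ (z ω)).onTest t (s ω)).2.top := by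
      cases t with
      | setScale i j =>
        refine ⟨?_, hz, htop⟩
        simp only [evalMachine, decide_eq_true_eq]
        exact measurableSet_lt hz.neg measurable_const
      | slope i j =>
        refine ⟨?_, hlam, htop⟩
        simp only [evalMachine, decide_eq_true_eq]
        exact measurableSet_lt hlam.neg measurable_const
      | setTop k =>
        refine ⟨?_, hlam, (hlam.mul_const _).const_add _⟩
        simp only [evalMachine, decide_eq_true_eq]
        exact measurableSet_le (((hlam.mul_const _).const_add _).sub_const _) measurable_const
      | inStrip i =>
        refine ⟨?_, hlam, htop⟩
        simp only [evalMachine, decide_eq_true_eq]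
        exact measurableSet_le (htop.sub_const _) ((hlam.mul_const _).const_add _)
      | outStrip i =>
        refine ⟨?_, hlam, htop⟩
        simp only [evalMachine, decide_eq_true_eq]
        exact (measurableSet_le (htop.sub_const _) ((hlam.mul_const _).const_add _)).compl
    obtain ⟨k1, k2, k3⟩ := key
    have ht := ih true (fun ω => ((evalMachine F a h τ (z ω)).onTest t (s ω)).2) k2 k3
    have hf := ih false (fun ω => ((evalMachine F a h τ (z ω)).onTest t (s ω)).2) k2 k3
    simp only [run_test]
    constructor
    · convert (Measurable.ite k1 ht.1 hf.1).add_const 1 using 2 with ω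
      by_cases hb : ((evalMachine F a h τ (z ω)).onTest t (s ω)).1 = true
      · rw [if_pos hb, hb]
      · rw [if_neg hb, Bool.eq_false_of_not_eq_true hb]
      infer_instance
    · convert Measurable.ite k1 ht.2 hf.2 using 2 with ω
      by_cases hb : ((evalMachine F a h τ (z ω)).onTest t (s ω)).1 = true
      · rw [if_pos hb, hb]
      · rw [if_neg hb, Bool.eq_false_of_not_eq_true hb]
      infer_instance
  | act b q ih =>
    have := ih (fun ω => (evalMachine F a h τ (z ω)).onAct b (s ω))
      (by cases b <;> exact hlam) (by cases b <;> exact htop)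
    simp only [run_act, List.length_cons]
    exact ⟨this.1, this.2.add_const 1⟩

theorem measurable_evalTime {Ω : Type*} [MeasurableSpace Ω] (F : Arithmetic) (P : ℂ[X]) (p : ℕ)
    (m : ℝ) {z : Ω → ℂ} (hz : Measurable fun ω => Real.logb 2 ‖z ω‖) :
    Measurable fun ω => evalTime F P p m (z ω) := by
  obtain ⟨h1, h2⟩ := measurable_run F P.coeff (preRun P p).state (thickness P.natDegree p) hz
    (evaluation (preRun P p).value) (fun _ => ⟨0, (preRun P p).state 0, 0, 0⟩)
    measurable_const measurable_const
  exact (measurable_from_top.comp h1).add ((measurable_from_top.comp h2).mul_const m)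

/-! ### Logarithmic coordinates on the sphere and on the circle -/

theorem lintegral_norm_complex {G : ℝ → ENNReal} (hG : Measurable G) :
    ∫⁻ z : ℂ, G ‖z‖ = ENNReal.ofReal (2 * Real.pi) *
      ∫⁻ r in Set.Ioi (0 : ℝ), ENNReal.ofReal r * G r := by
  rw [← Complex.lintegral_comp_polarCoord_symm]
  have h1 : ∫⁻ q in polarCoord.target, ENNReal.ofReal q.1 • G ‖Complex.polarCoord.symm q‖ =
      ∫⁻ q in Set.Ioi (0 : ℝ) ×ˢ Set.Ioo (-Real.pi) Real.pi, ENNReal.ofReal q.1 * G q.1 := by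
    rw [polarCoord_target]
    refine setLIntegral_congr_fun (measurableSet_Ioi.prod measurableSet_Ioo) fun q hq => ?_
    have : (0 : ℝ) < q.1 := hq.1
    simp only [smul_eq_mul, Complex.norm_polarCoord_symm, abs_of_pos this]
  have hm : Measurable fun r : ℝ => ENNReal.ofReal r * G r :=
    ENNReal.measurable_ofReal.mul hG
  have hm' : Measurable fun q : ℝ × ℝ => ENNReal.ofReal q.1 * G q.1 := hm.comp measurable_fst
  rw [h1, Measure.volume_eq_prod, ← Measure.prod_restrict, lintegral_prod _ hm'.aemeasurable]
  simp only [lintegral_const, Measure.restrict_apply MeasurableSet.univ, Set.univ_inter,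
    Real.volume_Ioo]
  rw [lintegral_mul_const _ hm, mul_comm]
  congr 2
  ring

theorem lintegral_abs_real {G : ℝ → ENNReal} (hG : Measurable G) :
    ∫⁻ x : ℝ, G |x| = 2 * ∫⁻ r in Set.Ioi (0 : ℝ), G r := by
  have h1 : ∫⁻ x in Set.Ioi (0 : ℝ), G |x| = ∫⁻ r in Set.Ioi (0 : ℝ), G r :=
    setLIntegral_congr_fun measurableSet_Ioi fun x hx => by
      simp only [abs_of_pos (Set.mem_Ioi.1 hx)]
  have h2 : ∫⁻ x in Set.Iic (0 : ℝ), G |x| = ∫⁻ r in Set.Ioi (0 : ℝ), G r := by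
    have hm : Measurable fun x : ℝ => G |x| := hG.comp measurable_id.abs
    rw [← h1, setLIntegral_congr (Iio_ae_eq_Iic (a := (0 : ℝ))).symm]
    have := (Measure.measurePreserving_neg (volume : Measure ℝ)).setLIntegral_comp_preimage
      (s := Set.Ioi (0 : ℝ)) measurableSet_Ioi hm
    rw [← this]
    simp
  rw [← lintegral_add_compl _ measurableSet_Ioi (A := Set.Ioi (0 : ℝ)), Set.compl_Ioi, h1, h2,
    two_mul]

theorem lintegral_Ioi_two_rpow (H : ℝ → ENNReal) :
    ∫⁻ r in Set.Ioi (0 : ℝ), H r =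
      ∫⁻ t : ℝ, ENNReal.ofReal (Real.log 2 * 2 ^ t) * H ((2 : ℝ) ^ t) := by
  have himg : (fun t : ℝ => (2 : ℝ) ^ t) '' Set.univ = Set.Ioi 0 := by
    ext r
    simp only [Set.image_univ, Set.mem_range, Set.mem_Ioi]
    constructor
    · rintro ⟨t, rfl⟩
      positivity
    · exact fun hr => ⟨Real.logb 2 r, Real.rpow_logb (by norm_num) (by norm_num) hr⟩
  have := lintegral_image_eq_lintegral_abs_deriv_mul (s := Set.univ)
    (f := fun t : ℝ => (2 : ℝ) ^ t) (f' := fun t => Real.log 2 * 2 ^ t) MeasurableSet.univ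
    (fun t _ => by
      have := (hasDerivAt_id t).const_rpow (a := 2) (by norm_num)
      exact (by simpa using this : HasDerivAt (fun t : ℝ => (2 : ℝ) ^ t)
        (Real.log 2 * 2 ^ t) t).hasDerivWithinAt)
    (fun x _ y _ hxy => by
      have h := congrArg (Real.logb 2) hxy
      simpa using h) H
  rw [himg] at this
  rw [this, setLIntegral_univ]
  refine lintegral_congr fun t => ?_
  rw [abs_of_pos (mul_pos (Real.log_pos (by norm_num)) (by positivity))]

theorem measurable_logb_norm : Measurable fun z : ℂ => Real.logb 2 ‖z‖ :=
  (Real.measurable_log.comp measurable_norm).div_const _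

/-- On the sphere, the density of `λ = log₂ |z|` is `2 log 2 / (2 ^ λ + 2 ^ (-λ))²`, whose maximum
is `log 2 / 2`. -/
theorem lintegral_logb_sphereMeasure_le {f : ℝ → ENNReal} (hf : Measurable f) :
    ∫⁻ z, f (Real.logb 2 ‖z‖) ∂sphereMeasure ≤
      ENNReal.ofReal (Real.log 2 / 2) * ∫⁻ t, f t := by
  have hdens : Measurable fun r : ℝ => ENNReal.ofReal (1 / (Real.pi * (1 + r ^ 2) ^ 2)) := by
    fun_prop
  have hlog : Measurable fun r : ℝ => f (Real.logb 2 r) :=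
    hf.comp (Real.measurable_log.div_const _)
  have hdens' : Measurable fun z : ℂ => ENNReal.ofReal (1 / (Real.pi * (1 + ‖z‖ ^ 2) ^ 2)) :=
    hdens.comp measurable_norm
  have hlog' : Measurable fun z : ℂ => f (Real.logb 2 ‖z‖) := hlog.comp measurable_norm
  rw [sphereMeasure, lintegral_withDensity_eq_lintegral_mul _ hdens' hlog']
  simp only [Pi.mul_apply]
  have hprod : Measurable fun r : ℝ =>
      ENNReal.ofReal (1 / (Real.pi * (1 + r ^ 2) ^ 2)) * f (Real.logb 2 r) := hdens.mul hlog
  rw [lintegral_norm_complex hprod, lintegral_Ioi_two_rpow,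
    ← lintegral_const_mul' _ _ ENNReal.ofReal_ne_top,
    ← lintegral_const_mul' _ _ ENNReal.ofReal_ne_top]
  refine lintegral_mono fun t => ?_
  rw [Real.logb_rpow (by norm_num) (by norm_num)]
  have hx : (0 : ℝ) < 2 ^ t := by positivity
  have hl : 0 < Real.log 2 := Real.log_pos (by norm_num)
  generalize (2 : ℝ) ^ t = x at hx
  rw [← mul_assoc, ← mul_assoc, ← mul_assoc, ← ENNReal.ofReal_mul (by positivity),
    ← ENNReal.ofReal_mul (by positivity), ← ENNReal.ofReal_mul (by positivity)]
  refine mul_le_mul_left (ENNReal.ofReal_le_ofReal ?_) _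
  have e : 2 * Real.pi * (Real.log 2 * x) * x * (1 / (Real.pi * (1 + x ^ 2) ^ 2)) =
      Real.log 2 * (2 * x ^ 2 / (1 + x ^ 2) ^ 2) := by
    field_simp
  rw [e, div_eq_mul_inv (Real.log 2)]
  refine mul_le_mul_of_nonneg_left ?_ hl.le
  rw [div_le_iff₀ (by positivity)]
  nlinarith [sq_nonneg (1 - x ^ 2)]

/-- On the circle, the density of `λ = log₂ |x|` is `2 log 2 / (π (2 ^ λ + 2 ^ (-λ)))`, whose
maximum is `log 2 / π`. -/
theorem lintegral_logb_circleMeasure_le {f : ℝ → ENNReal} (hf : Measurable f) :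
    ∫⁻ x : ℝ, f (Real.logb 2 ‖(x : ℂ)‖) ∂circleMeasure ≤
      ENNReal.ofReal (Real.log 2 / Real.pi) * ∫⁻ t, f t := by
  have hdens : Measurable fun r : ℝ => ENNReal.ofReal (1 / (Real.pi * (1 + r ^ 2))) := by
    fun_prop
  have hlog : Measurable fun r : ℝ => f (Real.logb 2 r) :=
    hf.comp (Real.measurable_log.div_const _)
  simp only [Complex.norm_real, Real.norm_eq_abs]
  have hlog' : Measurable fun x : ℝ => f (Real.logb 2 |x|) := hlog.comp measurable_id.abs
  rw [circleMeasure, lintegral_withDensity_eq_lintegral_mul _ hdens hlog']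
  have habs : ∀ x : ℝ, ((fun r : ℝ => ENNReal.ofReal (1 / (Real.pi * (1 + r ^ 2)))) *
      fun x => f (Real.logb 2 |x|)) x =
      ENNReal.ofReal (1 / (Real.pi * (1 + |x| ^ 2))) * f (Real.logb 2 |x|) := fun x => by
    simp only [Pi.mul_apply, sq_abs]
  simp only [habs]
  have hprod : Measurable fun r : ℝ =>
      ENNReal.ofReal (1 / (Real.pi * (1 + r ^ 2))) * f (Real.logb 2 r) := hdens.mul hlog
  rw [lintegral_abs_real hprod, lintegral_Ioi_two_rpow,
    ← lintegral_const_mul' _ _ ENNReal.ofNat_ne_top,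
    ← lintegral_const_mul' _ _ ENNReal.ofReal_ne_top]
  refine lintegral_mono fun t => ?_
  rw [Real.logb_rpow (by norm_num) (by norm_num)]
  have hx : (0 : ℝ) < 2 ^ t := by positivity
  have hl : 0 < Real.log 2 := Real.log_pos (by norm_num)
  generalize (2 : ℝ) ^ t = x at hx
  rw [← mul_assoc, ← mul_assoc, ← ENNReal.ofReal_ofNat 2, ← ENNReal.ofReal_mul (by positivity),
    ← ENNReal.ofReal_mul (by positivity)]
  refine mul_le_mul_left (ENNReal.ofReal_le_ofReal ?_) _
  have e : 2 * (Real.log 2 * x) * (1 / (Real.pi * (1 + x ^ 2))) =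
      Real.log 2 / Real.pi * (2 * x / (1 + x ^ 2)) := by
    field_simp
  rw [e]
  refine mul_le_of_le_one_right (by positivity) ?_
  rw [div_le_one (by positivity)]
  nlinarith [sq_nonneg (1 - x)]

instance isProbabilityMeasure_sphereMeasure : IsProbabilityMeasure sphereMeasure := by
  constructor
  have hdens : Measurable fun r : ℝ => ENNReal.ofReal (1 / (Real.pi * (1 + r ^ 2) ^ 2)) := by
    fun_prop
  rw [sphereMeasure, withDensity_apply _ MeasurableSet.univ, setLIntegral_univ,
    lintegral_norm_complex hdens, ← lintegral_const_mul' _ _ ENNReal.ofReal_ne_top]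
  have hderiv : ∀ x ∈ Set.Ici (0 : ℝ),
      HasDerivAt (fun r : ℝ => -(1 + r ^ 2)⁻¹) (2 * x / (1 + x ^ 2) ^ 2) x := by
    intro x _
    have h := (((hasDerivAt_pow 2 x).const_add 1).fun_inv (by positivity)).fun_neg
    refine h.congr_deriv ?_
    simp [neg_div]
  have hpos : ∀ x ∈ Set.Ioi (0 : ℝ), 0 ≤ 2 * x / (1 + x ^ 2) ^ 2 := by
    intro x hx
    have := Set.mem_Ioi.1 hx
    positivity
  have hlim : Filter.Tendsto (fun r : ℝ => -(1 + r ^ 2)⁻¹) Filter.atTop (nhds 0) := by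
    rw [← neg_zero]
    refine (Filter.Tendsto.inv_tendsto_atTop ?_).neg
    exact Filter.tendsto_atTop_add_const_left _ _ (Filter.tendsto_pow_atTop (by norm_num))
  have hint := integral_Ioi_of_hasDerivAt_of_nonneg' hderiv hpos hlim
  have hI := integrableOn_Ioi_deriv_of_nonneg' hderiv hpos hlim
  have heq : ∀ r ∈ Set.Ioi (0 : ℝ), ENNReal.ofReal (2 * Real.pi) *
      (ENNReal.ofReal r * ENNReal.ofReal (1 / (Real.pi * (1 + r ^ 2) ^ 2))) =
      ENNReal.ofReal (2 * r / (1 + r ^ 2) ^ 2) := by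
    intro r hr
    have := Set.mem_Ioi.1 hr
    rw [← mul_assoc, ← ENNReal.ofReal_mul (by positivity), ← ENNReal.ofReal_mul (by positivity)]
    congr 1
    field_simp
  rw [setLIntegral_congr_fun measurableSet_Ioi heq,
    ← ofReal_integral_eq_lintegral_ofReal hI
      ((ae_restrict_iff' measurableSet_Ioi).2 (Filter.Eventually.of_forall hpos)), hint]
  simp

instance isProbabilityMeasure_circleMeasure : IsProbabilityMeasure circleMeasure := by
  constructor
  have e : ∀ x : ℝ, 1 / (Real.pi * (1 + x ^ 2)) = Real.pi⁻¹ * (1 + x ^ 2)⁻¹ := fun x => by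
    rw [one_div, mul_inv]
  rw [circleMeasure, withDensity_apply _ MeasurableSet.univ, setLIntegral_univ]
  simp only [e]
  rw [← ofReal_integral_eq_lintegral_ofReal (integrable_inv_one_add_sq.const_mul _)
    (Filter.Eventually.of_forall fun x => by positivity), integral_const_mul,
    integral_univ_inv_one_add_sq, inv_mul_cancel₀ Real.pi_ne_zero, ENNReal.ofReal_one]

/-! ### Second differences -/

/-- The second difference with step `δ` of a function with slopes in `[0, d]` has integral at most
`d δ²`: it is the first difference of `g (t + δ) - g t`, whose values are in `[0, d δ]`. -/
theorem lintegral_second_difference_le {g : ℝ → ℝ} {d δ : ℝ} (hδ : 0 < δ) (hg : Continuous g)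
    (hmono : ∀ x t, 0 ≤ t → g x ≤ g (x + t)) (hlip : ∀ x t, 0 ≤ t → g (x + t) ≤ g x + d * t)
    (hconv : ∀ x, 0 ≤ g (x + δ) + g (x - δ) - 2 * g x) :
    ∫⁻ x, ENNReal.ofReal (g (x + δ) + g (x - δ) - 2 * g x) ≤ ENNReal.ofReal (d * δ ^ 2) := by
  set φ : ℝ → ℝ := fun x => g (x + δ) - g x with hφ
  have hφc : Continuous φ := (hg.comp (continuous_id.add continuous_const)).sub hg
  have hDc : Continuous fun x => g (x + δ) + g (x - δ) - 2 * g x := by fun_prop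
  have hD : ∀ x, g (x + δ) + g (x - δ) - 2 * g x = φ x - φ (x - δ) := fun x => by
    simp only [hφ, sub_add_cancel]; ring
  have hbound : ∀ A : ℝ, ∫ x in (-A)..A, (g (x + δ) + g (x - δ) - 2 * g x) ≤ d * δ ^ 2 := by
    intro A
    simp only [hD]
    have hint : ∀ a b, IntervalIntegrable φ volume a b := fun a b => hφc.intervalIntegrable a b
    have hint' : IntervalIntegrable (fun x => φ (x - δ)) volume (-A) A :=
      (hφc.comp (continuous_id.sub continuous_const)).intervalIntegrable _ _
    rw [intervalIntegral.integral_sub (hint _ _) hint',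
      intervalIntegral.integral_comp_sub_right φ δ,
      intervalIntegral.integral_interval_sub_interval_comm' (hint _ _) (hint _ _) (hint _ _)]
    have h1 : ∫ x in (A - δ)..A, φ x ≤ ∫ x in (A - δ)..A, d * δ :=
      intervalIntegral.integral_mono_on (by linarith) (hint _ _) intervalIntegrable_const
        fun x _ => by simp only [hφ]; linarith [hlip x δ hδ.le]
    have h2 : 0 ≤ ∫ x in (-A - δ)..(-A), φ x :=
      intervalIntegral.integral_nonneg (by linarith)
        fun x _ => by simp only [hφ]; linarith [hmono x δ hδ.le]
    rw [intervalIntegral.integral_const, smul_eq_mul] at h1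
    nlinarith
  have hint : Integrable fun x => g (x + δ) + g (x - δ) - 2 * g x := by
    refine integrable_of_intervalIntegral_norm_bounded (d * δ ^ 2)
      (fun A : ℝ => (hDc.integrableOn_Icc (a := -A) (b := A)).mono_set Set.Ioc_subset_Icc_self)
      Filter.tendsto_neg_atTop_atBot Filter.tendsto_id (Filter.Eventually.of_forall fun A => ?_)
    simp only [Real.norm_of_nonneg (hconv _)]
    exact hbound A
  rw [← ofReal_integral_eq_lintegral_ofReal hint (Filter.Eventually.of_forall hconv)]
  refine ENNReal.ofReal_le_ofReal ?_
  exact le_of_tendsto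
    (intervalIntegral_tendsto_integral hint Filter.tendsto_neg_atTop_atBot Filter.tendsto_id)
    (Filter.Eventually.of_forall hbound)

/-! ### The average length of the window -/

/-- The maximum of `Ê_P + λ Id` over the integers of `[0, d]`, as a function of `λ`. -/
def support (P : ℂ[X]) (lam : ℝ) : ℝ :=
  (Finset.range (P.natDegree + 1)).sup' Finset.nonempty_range_add_one fun k => tilt P lam k

section Support

variable (P : ℂ[X])

theorem tilt_add (lam t x : ℝ) : tilt P (lam + t) x = tilt P lam x + t * x := by
  simp only [tilt]; ring

theorem tilt_le_support (lam : ℝ) {k : ℕ} (hk : k ≤ P.natDegree) :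
    tilt P lam k ≤ support P lam :=
  Finset.le_sup' (fun k : ℕ => tilt P lam k) (Finset.mem_range_succ_iff.2 hk)

theorem exists_tilt_eq_support (lam : ℝ) :
    ∃ k : ℕ, k ≤ P.natDegree ∧ support P lam = tilt P lam k := by
  obtain ⟨k, hk, h⟩ := Finset.exists_mem_eq_sup' (Finset.nonempty_range_add_one (n := P.natDegree))
    fun k : ℕ => tilt P lam k
  exact ⟨k, Finset.mem_range_succ_iff.1 hk, h⟩

theorem support_le_add (lam t : ℝ) (ht : 0 ≤ t) : support P lam ≤ support P (lam + t) := by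
  obtain ⟨k, hk, h⟩ := exists_tilt_eq_support P lam
  have := tilt_le_support P (lam + t) hk
  rw [tilt_add] at this
  have : 0 ≤ t * k := by positivity
  linarith

theorem support_add_le (lam t : ℝ) (ht : 0 ≤ t) :
    support P (lam + t) ≤ support P lam + P.natDegree * t := by
  obtain ⟨k, hk, h⟩ := exists_tilt_eq_support P (lam + t)
  have := tilt_le_support P lam hk
  rw [tilt_add] at h
  have hk' : (k : ℝ) ≤ P.natDegree := by exact_mod_cast hk
  nlinarith

theorem support_second_difference_nonneg (δ lam : ℝ) :
    0 ≤ support P (lam + δ) + support P (lam - δ) - 2 * support P lam := by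
  obtain ⟨k, hk, h⟩ := exists_tilt_eq_support P lam
  have h1 := tilt_le_support P (lam + δ) hk
  have h2 := tilt_le_support P (lam - δ) hk
  rw [tilt_add] at h1
  rw [sub_eq_add_neg, tilt_add] at h2
  rw [← sub_eq_add_neg] at h2
  linarith

theorem continuous_support : Continuous (support P) := by
  refine Continuous.finset_sup'_apply _ fun k _ => ?_
  exact continuous_const.add (continuous_id.mul continuous_const)

/-- The window is narrow where the support function is nearly affine: comparing the values at its
edges with those of the support function at `λ ± δ` bounds its length by a second difference. -/
theorem window_length_le {p : ℕ} {z : ℂ} {l r : ℕ} (hlr : l ≤ r)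
    (hwin : window P p z = Finset.Icc l r) {δ : ℝ} (hδ : 0 < δ) :
    (r : ℝ) - l ≤ (support P (Real.logb 2 ‖z‖ + δ) + support P (Real.logb 2 ‖z‖ - δ) -
      2 * support P (Real.logb 2 ‖z‖) + 2 * thickness P.natDegree p) / δ := by
  set lam := Real.logb 2 ‖z‖ with hlam
  have hedge : ∀ k ∈ window P p z, k ≤ P.natDegree ∧
      support P lam - thickness P.natDegree p ≤ tilt P lam k := by
    intro k hk
    simp only [window, Finset.mem_filter, Finset.mem_range, Nat.lt_succ_iff] at hk
    refine ⟨hk.1, ?_⟩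
    obtain ⟨i, hi, h⟩ := exists_tilt_eq_support P lam
    rw [h]
    exact hk.2 i ⟨Nat.cast_nonneg _, by exact_mod_cast hi⟩
  obtain ⟨hl, hl'⟩ := hedge l (by rw [hwin]; exact Finset.left_mem_Icc.2 hlr)
  obtain ⟨hr, hr'⟩ := hedge r (by rw [hwin]; exact Finset.right_mem_Icc.2 hlr)
  have h1 := tilt_le_support P (lam + δ) hr
  have h2 := tilt_le_support P (lam - δ) hl
  rw [tilt_add] at h1
  rw [sub_eq_add_neg, tilt_add] at h2
  rw [← sub_eq_add_neg] at h2
  rw [le_div_iff₀ hδ]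
  linarith

end Support

/-- The average of the second difference of the support function, for a random point whose
logarithm has density at most `c`. -/
theorem integral_second_difference_le (P : ℂ[X]) {Ω : Type*} [MeasurableSpace Ω] {μ : Measure Ω}
    [IsProbabilityMeasure μ] {lam : Ω → ℝ} (hlam : Measurable lam) {c : ℝ} (hc : 0 ≤ c)
    (hμ : ∀ f : ℝ → ENNReal, Measurable f →
      ∫⁻ ω, f (lam ω) ∂μ ≤ ENNReal.ofReal c * ∫⁻ t, f t) {δ : ℝ} (hδ : 0 < δ) :
    Integrable (fun ω => support P (lam ω + δ) + support P (lam ω - δ) - 2 * support P (lam ω)) μ ∧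
    ∫ ω, (support P (lam ω + δ) + support P (lam ω - δ) - 2 * support P (lam ω)) ∂μ ≤
      c * P.natDegree * δ ^ 2 := by
  have hcont : Continuous fun x => support P (x + δ) + support P (x - δ) - 2 * support P x := by
    have := continuous_support P
    fun_prop
  have hmeas : Measurable fun ω =>
      support P (lam ω + δ) + support P (lam ω - δ) - 2 * support P (lam ω) :=
    hcont.measurable.comp hlam
  have hnn : ∀ ω, 0 ≤ support P (lam ω + δ) + support P (lam ω - δ) - 2 * support P (lam ω) :=
    fun ω => support_second_difference_nonneg P δ (lam ω)
  constructor
  · refine Integrable.of_bound hmeas.aestronglyMeasurable (P.natDegree * δ)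
      (Filter.Eventually.of_forall fun ω => ?_)
    rw [Real.norm_of_nonneg (hnn ω)]
    have h1 := support_add_le P (lam ω) δ hδ.le
    have h2 := support_le_add P (lam ω - δ) δ hδ.le
    rw [sub_add_cancel] at h2
    linarith
  · rw [integral_eq_lintegral_of_nonneg_ae (Filter.Eventually.of_forall hnn)
      hmeas.aestronglyMeasurable]
    refine ENNReal.toReal_le_of_le_ofReal (by positivity) ?_
    refine (hμ _ hcont.measurable.ennreal_ofReal).trans ?_
    rw [mul_assoc, ENNReal.ofReal_mul hc]
    gcongr
    exact lintegral_second_difference_le hδ (continuous_support P) (support_le_add P)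
      (support_add_le P) (support_second_difference_nonneg P δ)

/-! ### The average evaluation time -/

theorem evalTime_le {P : ℂ[X]} (p : ℕ) (hd : 1 ≤ P.natDegree) (h0 : P.coeff 0 ≠ 0)
    (F : Arithmetic) {m : ℝ} (hm : 0 < m) (z : ℂ) :
    evalTime F P p m z ≤ 2 + 3 * Real.logb 2 P.natDegree + m * P.natDegree := by
  obtain ⟨l, r, -, hr, -, ht, ha, -, -⟩ := evalRun_spec p hd h0 F z
  have : ((evalRun F P p z).acts.length : ℝ) ≤ P.natDegree := by exact_mod_cast ha.trans hr
  rw [evalTime]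
  nlinarith

theorem evalTime_le_second_difference {P : ℂ[X]} (p : ℕ) (hd : 1 ≤ P.natDegree)
    (h0 : P.coeff 0 ≠ 0) (F : Arithmetic) {m : ℝ} (hm : 0 < m) (z : ℂ) {δ : ℝ} (hδ : 0 < δ) :
    evalTime F P p m z ≤ 2 + 3 * Real.logb 2 P.natDegree +
      (1 + 2 * Real.logb 2 P.natDegree + 2 * (p + Real.logb 2 P.natDegree + 4) / δ) * m +
      (m / δ) * (support P (Real.logb 2 ‖z‖ + δ) + support P (Real.logb 2 ‖z‖ - δ) -
        2 * support P (Real.logb 2 ‖z‖)) := by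
  obtain ⟨l, r, hlr, hr, hwin, ht, -, ha, -⟩ := evalRun_spec p hd h0 F z
  have hlen := window_length_le P hlr hwin hδ
  have hlog := natLog_le_logb hd
  have hll : (Nat.log 2 l : ℝ) ≤ Nat.log 2 P.natDegree := by
    exact_mod_cast Nat.log_mono_right (hlr.trans hr)
  have hth : thickness P.natDegree p ≤ p + Real.logb 2 P.natDegree + 4 := by
    rw [thickness_eq hd]; linarith
  set D := support P (Real.logb 2 ‖z‖ + δ) + support P (Real.logb 2 ‖z‖ - δ) -
    2 * support P (Real.logb 2 ‖z‖)
  set T := (p : ℝ) + Real.logb 2 P.natDegree + 4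
  have ha' : ((evalRun F P p z).acts.length : ℝ) ≤ (r : ℝ) - l + 1 + 2 * Nat.log 2 l := by
    rw [← Nat.cast_sub hlr]
    exact_mod_cast ha
  have hdiv : (D + 2 * thickness P.natDegree p) / δ ≤ (D + 2 * T) / δ := by gcongr
  have hA : ((evalRun F P p z).acts.length : ℝ) ≤
      1 + 2 * Real.logb 2 P.natDegree + 2 * T / δ + D / δ := by
    rw [add_div] at hdiv
    rw [add_div D (2 * T)] at hdiv
    rw [add_div] at hlen
    linarith
  have hAm := mul_le_mul_of_nonneg_right hA hm.le
  rw [evalTime]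
  have e : m / δ * D = D / δ * m := by ring
  rw [e]
  linarith

/-- The average evaluation time for a random point whose logarithm has density at most `c`. The step
of the second difference is `δ = κ √(T / d)` with `T = p + log₂ d + 4`, so that the window has mean
length at most `(2 / κ + c κ) √(d T)`; the best `κ` is `√(2 / c)`. -/
theorem average_evalTime_lt {P : ℂ[X]} {p : ℕ} (hp : 1 ≤ p) (hd : 1 ≤ P.natDegree)
    (h0 : P.coeff 0 ≠ 0) (F : Arithmetic) {m : ℝ} (hm : 0 < m) {Ω : Type*} [MeasurableSpace Ω]
    {μ : Measure Ω} [IsProbabilityMeasure μ] {z : Ω → ℂ}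
    (hz : Measurable fun ω => Real.logb 2 ‖z ω‖) {c κ K : ℝ} (hc : 0 ≤ c) (hκ : 0 < κ)
    (hμ : ∀ f : ℝ → ENNReal, Measurable f →
      ∫⁻ ω, f (Real.logb 2 ‖z ω‖) ∂μ ≤ ENNReal.ofReal c * ∫⁻ t, f t)
    (hK : 1.7673 ≤ K) (hcK : 2 / κ + c * κ + 0.12 ≤ K) :
    Integrable (fun ω => evalTime F P p m (z ω)) μ ∧
    ∫ ω, evalTime F P p m (z ω) ∂μ < 2 + 3 * Real.logb 2 P.natDegree +
      (2 * Real.logb 2 P.natDegree +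
        K * √((P.natDegree : ℝ) * (p + Real.logb 2 P.natDegree + 4))) * m := by
  have hlog0 : 0 ≤ Real.logb 2 (P.natDegree : ℝ) :=
    Real.logb_nonneg (by norm_num) (by exact_mod_cast hd)
  have hint : Integrable (fun ω => evalTime F P p m (z ω)) μ := by
    refine Integrable.of_bound (measurable_evalTime F P p m hz).aestronglyMeasurable
      (2 + 3 * Real.logb 2 P.natDegree + m * P.natDegree)
      (Filter.Eventually.of_forall fun ω => ?_)
    rw [Real.norm_of_nonneg (by rw [evalTime]; positivity)]
    exact evalTime_le p hd h0 F hm _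
  refine ⟨hint, ?_⟩
  have hp' : (1 : ℝ) ≤ p := by exact_mod_cast hp
  have hd' : (1 : ℝ) ≤ P.natDegree := by exact_mod_cast hd
  have hT5 : 5 ≤ (p : ℝ) + Real.logb 2 P.natDegree + 4 := by linarith
  have hsq : √((P.natDegree : ℝ) * (p + Real.logb 2 P.natDegree + 4)) ^ 2 =
      (P.natDegree : ℝ) * (p + Real.logb 2 P.natDegree + 4) := Real.sq_sqrt (by positivity)
  have hS0 : 0 < √((P.natDegree : ℝ) * (p + Real.logb 2 P.natDegree + 4)) :=
    Real.sqrt_pos.2 (by positivity)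
  rcases le_or_gt P.natDegree 15 with hsmall | hlarge
  · -- for small degrees, even the worst case `d` is less than `K √(d T)`, since `T ≥ 5`
    have hle := integral_mono hint (integrable_const _) fun ω => evalTime_le p hd h0 F hm (z ω)
    rw [integral_const, probReal_univ, one_smul] at hle
    refine hle.trans_lt ?_
    have hsmall' : (P.natDegree : ℝ) ≤ 15 := by exact_mod_cast hsmall
    set S := √((P.natDegree : ℝ) * (p + Real.logb 2 P.natDegree + 4))
    have hlt : (P.natDegree : ℝ) < 1.7673 * S := by
      refine lt_of_pow_lt_pow_left₀ 2 (by positivity) ?_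
      rw [mul_pow, hsq]
      nlinarith
    have hKS : 1.7673 * S ≤ K * S := mul_le_mul_of_nonneg_right hK hS0.le
    nlinarith
  · -- for large degrees, the margin `0.12 √(d T)` exceeds the remaining multiplication by `z ^ ℓ`
    have hlarge' : (16 : ℝ) ≤ P.natDegree := by exact_mod_cast hlarge
    set T := (p : ℝ) + Real.logb 2 P.natDegree + 4
    set S := √((P.natDegree : ℝ) * T)
    set δ := κ * S / P.natDegree with hδdef
    have hδ : 0 < δ := by positivity
    obtain ⟨hD, hD'⟩ := integral_second_difference_le P hz hc hμ hδ
    have hle := integral_mono hint ((integrable_const _).add (hD.const_mul (m / δ)))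
      fun ω => evalTime_le_second_difference p hd h0 F hm (z ω) hδ
    simp only [Pi.add_apply] at hle
    rw [integral_add (integrable_const _) (hD.const_mul _), integral_const, probReal_univ,
      one_smul, integral_const_mul] at hle
    refine hle.trans_lt ?_
    have h1 := mul_le_mul_of_nonneg_left hD' (show 0 ≤ m / δ by positivity)
    have e1 : m / δ * (c * P.natDegree * δ ^ 2) = c * κ * S * m := by
      rw [hδdef]; field_simp
    have e2 : 2 * T / δ = 2 / κ * S := by
      rw [hδdef]
      field_simp
      rw [hsq, mul_comm]
    rw [e1] at h1
    rw [e2]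
    have hS8 : 8.9 ≤ S := Real.le_sqrt_of_sq_le (by nlinarith)
    have hKS : (2 / κ + c * κ + 0.12) * S ≤ K * S := mul_le_mul_of_nonneg_right hcK hS0.le
    nlinarith

end

end FPE

theorem mainTheorem2 (w : ℕ) :
    ∃ C : ℝ, ∀ (P : ℂ[X]) (d p : ℕ) (M : ℕ → ℝ),
      P.natDegree = d → 1 ≤ d → P.coeff 0 ≠ 0 → 1 ≤ p → 0 < M p →
      -- The preconditioning phase computes the concave cover and the good indices.
      (∀ k ≤ d, (FPE.preRun P p).state k = FPE.concaveCover P k) ∧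
      (∀ k, k ∈ (FPE.preRun P p).value.good ↔ k ∈ FPE.goodIndices P p) ∧
      -- Its time and memory.
      (FPE.preTime P p : ℝ) ≤ d + 2 * d * Real.logb 2 d ∧
      (FPE.preMemory w P p : ℝ) ≤ C * (d * p) ∧
      -- In exact arithmetic, the evaluation phase computes the reduced polynomial.
      (∀ z : ℂ, z ≠ 0 →
        FPE.evalOutput FPE.Arithmetic.exact P p z = FPE.reducedValue P p z) ∧
      -- Evaluation time, for any (rounded) arithmetic.
      ∀ F : FPE.Arithmetic,
        -- average over the Riemann sphere
        (Integrable (fun z : ℂ => FPE.evalTime F P p (M p) z) FPE.sphereMeasure ∧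
          ∫ z : ℂ, FPE.evalTime F P p (M p) z ∂FPE.sphereMeasure <
            2 + 3 * Real.logb 2 d +
              (2 * Real.logb 2 d + 1.9046 * √((d : ℝ) * (p + Real.logb 2 d + 4))) * M p) ∧
        -- average over the real circle, for real polynomials
        ((∀ k, (P.coeff k).im = 0) →
          Integrable (fun x : ℝ => FPE.evalTime F P p (M p) (x : ℂ)) FPE.circleMeasure ∧
          ∫ x : ℝ, FPE.evalTime F P p (M p) (x : ℂ) ∂FPE.circleMeasure <
            2 + 3 * Real.logb 2 d +
              (2 * Real.logb 2 d + 1.7673 * √((d : ℝ) * (p + Real.logb 2 d + 4))) * M p) ∧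
        -- worst case
        ∀ z : ℂ, z ≠ 0 →
          FPE.evalTime F P p (M p) z ≤ 2 + 3 * Real.logb 2 d + M p * d := by
  refine ⟨((8 + 12 * w : ℕ) : ℝ), ?_⟩
  rintro P d p M rfl hd h0 hp hM
  have hpre := FPE.preSpec p hd h0
  refine ⟨hpre.state, hpre.good, FPE.preTime_le p hd h0, FPE.preMemory_le w hp hd h0, ?_, ?_⟩
  · intro z _
    obtain ⟨l, r, -, -, -, -, -, -, h⟩ := FPE.evalRun_spec p hd h0 FPE.Arithmetic.exact z
    exact h rfl
  · intro F
    have hlog2 := Real.log_two_lt_d9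
    have hlog2' := Real.log_pos (show (1 : ℝ) < 2 by norm_num)
    refine ⟨?_, fun _ => ?_, fun z _ => FPE.evalTime_le p hd h0 F hM z⟩
    · refine FPE.average_evalTime_lt hp hd h0 F hM FPE.measurable_logb_norm (by positivity)
        (show (0 : ℝ) < 2.4 by norm_num) (fun f hf => FPE.lintegral_logb_sphereMeasure_le hf)
        (by norm_num) ?_
      linarith
    · refine FPE.average_evalTime_lt hp hd h0 F hM
        (FPE.measurable_logb_norm.comp Complex.measurable_ofReal)
        (show 0 ≤ Real.log 2 / Real.pi by positivity)
        (show (0 : ℝ) < 3 by norm_num) (fun f hf => FPE.lintegral_logb_circleMeasure_le hf)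
        (by norm_num) ?_
      have : Real.log 2 / Real.pi ≤ 0.24 := by
        rw [div_le_iff₀ Real.pi_pos]
        linarith [Real.pi_gt_three]
      linarith
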